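/- Let $(\Omega,\mathcal A,\mathbb P)$ be a probability space and, for every $n\in\mathbb N=\{1,2,\dots\}$, let $a_n=(a_n(p,q))_{1\le p,q\le n}$ be a symmetric $n\times n$ matrix of real random variables on it. Pairs $P_1,\dots,P_\ell\in\{1,\dots,n\}^2$, $P_i=(p_i,q_i)$, are called fundamentally different if $\{p_i,q_i\}\neq\{p_j,q_j\}$ for all $i\neq j$. Suppose that $(a_n)_n$ is an approximately uncorrelated triangular scheme, i.e. there are real constants $(C(k))_{k\in\mathbb N}$ and $(C_n^{(\ell)})_{n,\ell\in\mathbb N}$ with $\lim_{n\to\infty}C_n^{(\ell)}=0$ for every $\ell\in\mathbb N$, such that for all $n,\ell\in\mathbb N$ and all fundamentally different $P_1,\dots,P_\ell\in\{1,\dots,n\}^2$ the following expectations exist and satisfy $$\text{(AU1)}\qquad \bigl|\mathbb E\,a_n(P_1)^{\delta_1}\cdots a_n(P_\ell)^{\delta_\ell}\bigr|\le \frac{C(\delta_1+\dots+\delta_\ell)}{n^{\frac12\#\{i\,:\,\delta_i=1\}}}\quad\text{for all }\delta_1,\dots,\delta_\ell\in\mathbb N,$$ $$\text{(AU2)}\qquad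 \bigl|\mathbb E\,a_n(P_1)^2\cdots a_n(P_\ell)^2-1\bigr|\le C_n^{(\ell)}.$$ For every $n\in\mathbb N$ let $b_n$ be an $n$-bandwidth, i.e. either $b_n=n$, or $b_n$ is odd with $1\le b_n<n$, and suppose that $b_n\to\infty$. Call $(p,q)\in\{1,\dots,n\}^2$ $b_n$-relevant if $b_n=n$ or $|p-q|\le\frac{b_n-1}{2}$ or $|p-q|\ge n-\frac{b_n-1}{2}$. Let $a_n^b(p,q)=a_n(p,q)$ if $(p,q)$ is $b_n$-relevant and $a_n^b(p,q)=0$ otherwise, and let $X_n=b_n^{-1/2}a_n^b$. Let $\sigma_n=\frac1n\sum_{i=1}^n\delta_{\lambda_i(X_n)}$ be the empirical spectral distribution of $X_n$, where $\lambda_1(X_n),\dots,\lambda_n(X_n)$ are the eigenvalues of $X_n$ with multiplicity, and let $\sigma$ be the semicircle distribution, with density $\frac1{2\pi}\sqrt{4-x^2}\,\mathbf 1_{[-2,2]}(x)$. Then: i) $\sigma_n\to\sigma$ weakly in probability, i.e. $\int f\,d\sigma_n\to\int f\,d\sigma$ in probability for every bounded continuous $f:\mathbb R\to\mathbb R$.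 ii) If there is a $p\in\mathbb N$ such that $\sum_n b_n^{-p}<\infty$, and if for every $\ell\in\mathbb N$ the sequence $(C_n^{(\ell)})_n$ is summable, then $\sigma_n\to\sigma$ weakly almost surely, i.e. almost surely $\int f\,d\sigma_n\to\int f\,d\sigma$ for all bounded continuous $f:\mathbb R\to\mathbb R$. -/

import Mathlib

open MeasureTheory Filter
open scoped NNReal ENNReal Topology BoundedContinuousFunction

namespace BandMatrix

noncomputable section

/-! ### Approximately uncorrelated triangular schemes -/

/-- The index pairs `P 0, …, P (ℓ - 1)` are fundamentally different: the unordered pairs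
`{p_i, q_i}` are pairwise distinct. -/
def FundamentallyDifferent {n ℓ : ℕ} (P : Fin ℓ → Fin n × Fin n) : Prop :=
  ∀ i j : Fin ℓ, i ≠ j → s((P i).1, (P i).2) ≠ s((P j).1, (P j).2)

/-- `(a_n)` is an approximately uncorrelated triangular scheme with constants `C k` and
`Cn ℓ n` (the latter is written `C_n^{(ℓ)}`). The expectations in the two conditions are required to
exist, which is the content of `integrable`. The values `C 0`, `Cn 0 n` play no role. -/
structure IsApproxUncorrelated {Ω : Type*} [MeasurableSpace Ω] (μ : Measure Ω)
    (a : (n : ℕ) → Ω → Matrix (Fin n) (Fin n) ℝ) (C : ℕ → ℝ) (Cn : ℕ → ℕ → ℝ) : Prop where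
  measurable : ∀ (n : ℕ) (p q : Fin n), Measurable fun ω => a n ω p q
  symm : ∀ (n : ℕ) (ω : Ω), (a n ω).IsSymm
  tendsto_zero : ∀ ℓ : ℕ, 1 ≤ ℓ → Tendsto (fun n => Cn ℓ n) atTop (𝓝 0)
  integrable : ∀ (n ℓ : ℕ), 1 ≤ ℓ → ∀ P : Fin ℓ → Fin n × Fin n, FundamentallyDifferent P →
    ∀ δ : Fin ℓ → ℕ, (∀ i, 1 ≤ δ i) →
      Integrable (fun ω => ∏ i, a n ω (P i).1 (P i).2 ^ δ i) μ
  au1 : ∀ (n ℓ : ℕ), 1 ≤ ℓ → ∀ P : Fin ℓ → Fin n × Fin n, FundamentallyDifferent P →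
    ∀ δ : Fin ℓ → ℕ, (∀ i, 1 ≤ δ i) →
      |∫ ω, ∏ i, a n ω (P i).1 (P i).2 ^ δ i ∂μ| ≤
        C (∑ i, δ i) / (n : ℝ) ^ ((1 / 2 : ℝ) * (Finset.univ.filter fun i => δ i = 1).card)
  au2 : ∀ (n ℓ : ℕ), 1 ≤ ℓ → ∀ P : Fin ℓ → Fin n × Fin n, FundamentallyDifferent P →
      |∫ ω, ∏ i, a n ω (P i).1 (P i).2 ^ 2 ∂μ - 1| ≤ Cn ℓ n

/-! ### Periodic band matrices -/

/-- `b` is an `n`-bandwidth: an odd number with `1 ≤ b < n`, or `b = n`. -/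
def IsBandwidth (n b : ℕ) : Prop := (1 ≤ b ∧ b < n ∧ Odd b) ∨ b = n

/-- The index pair `(p, q)` is `b`-relevant: `b = n`, `|p - q| ≤ (b - 1) / 2` or
`|p - q| ≥ n - (b - 1) / 2`. -/
def Relevant (n b : ℕ) (p q : Fin n) : Prop :=
  b = n ∨ |((p : ℕ) : ℝ) - ((q : ℕ) : ℝ)| ≤ ((b : ℝ) - 1) / 2 ∨
    (n : ℝ) - ((b : ℝ) - 1) / 2 ≤ |((p : ℕ) : ℝ) - ((q : ℕ) : ℝ)|

lemma Relevant.comm {n b : ℕ} {p q : Fin n} : Relevant n b p q ↔ Relevant n b q p := by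
  unfold Relevant
  rw [abs_sub_comm]

open Classical in
/-- The matrix `A^b` obtained from `A` by deleting the entries that are not `b`-relevant. -/
def band {n : ℕ} (b : ℕ) (A : Matrix (Fin n) (Fin n) ℝ) : Matrix (Fin n) (Fin n) ℝ :=
  Matrix.of fun p q => if Relevant n b p q then A p q else 0

/-- The rescaled periodic band matrix `b^{-1/2} A^b`. -/
def scaledBand {n : ℕ} (b : ℕ) (A : Matrix (Fin n) (Fin n) ℝ) : Matrix (Fin n) (Fin n) ℝ :=
  (1 / √(b : ℝ)) • band b A

lemma isHermitian_scaledBand {n : ℕ} (b : ℕ) {A : Matrix (Fin n) (Fin n) ℝ} (hA : A.IsSymm) :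
    (scaledBand b A).IsHermitian := by
  ext p q
  have h := hA.apply p q
  have hr : Relevant n b q p ↔ Relevant n b p q := Relevant.comm
  by_cases hp : Relevant n b p q
  · simp [scaledBand, band, hp, hr.mpr hp, h]
  · simp [scaledBand, band, hp, mt hr.mp hp]

/-! ### Empirical spectral distribution and semicircle law -/

/-- The unit point mass at `x`. -/
def diracFiniteMeasure (x : ℝ) : FiniteMeasure ℝ := ⟨Measure.dirac x, inferInstance⟩

/-- The empirical spectral distribution `n⁻¹ ∑ δ_{λ_i}` of a real symmetric `n × n` matrix, with
eigenvalues counted with multiplicity; a probability measure for `n ≥ 1`, and `0` for `n = 0`. -/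
def esd {n : ℕ} (A : Matrix (Fin n) (Fin n) ℝ) (hA : A.IsHermitian) : FiniteMeasure ℝ :=
  (n : ℝ≥0)⁻¹ • ∑ i, diracFiniteMeasure (hA.eigenvalues i)

/-- The semicircle distribution, with density `(2π)⁻¹ √(4 - x²)` on `[-2, 2]`
(`√` of a negative number is `0`). -/
def semicircleMeasure : Measure ℝ :=
  volume.withDensity fun x => ENNReal.ofReal (1 / (2 * Real.pi) * √(4 - x ^ 2))

lemma integral_semicircle : ∫ x in (-2 : ℝ)..2, √(4 - x ^ 2) = 2 * Real.pi := by
  have h := intervalIntegral.integral_comp_mul_left (a := -1) (b := 1)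
    (fun x : ℝ => √(4 - x ^ 2)) (c := 2) two_ne_zero
  have h2 : ∀ x : ℝ, √(4 - (2 * x) ^ 2) = 2 * √(1 - x ^ 2) := by
    intro x
    rw [show 4 - (2 * x) ^ 2 = 2 ^ 2 * (1 - x ^ 2) by ring,
      Real.sqrt_mul (by norm_num), Real.sqrt_sq (by norm_num)]
  simp only [h2, intervalIntegral.integral_const_mul, integral_sqrt_one_sub_sq] at h
  norm_num at h
  linarith

instance : IsProbabilityMeasure semicircleMeasure := by
  constructor
  have h0 : ∀ x ∉ Set.Ioc (-2 : ℝ) 2, ENNReal.ofReal (1 / (2 * Real.pi) * √(4 - x ^ 2)) = 0 := by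
    intro x hx
    have : 4 - x ^ 2 ≤ 0 := by
      simp only [Set.mem_Ioc, not_and_or, not_lt, not_le] at hx
      rcases hx with hx | hx <;> nlinarith
    simp [Real.sqrt_eq_zero_of_nonpos this]
  have hc : Continuous fun x : ℝ => 1 / (2 * Real.pi) * √(4 - x ^ 2) := by fun_prop
  rw [semicircleMeasure, withDensity_apply _ MeasurableSet.univ, Measure.restrict_univ,
    ← setLIntegral_eq_of_support_subset (s := Set.Ioc (-2 : ℝ) 2)
      (fun x hx => by by_contra h; exact hx (h0 x h)),
    ← ofReal_integral_eq_lintegral_ofReal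
      ((hc.integrableOn_Icc).mono_set Set.Ioc_subset_Icc_self)
      (Eventually.of_forall fun x => by positivity),
    ← intervalIntegral.integral_of_le (by norm_num), intervalIntegral.integral_const_mul,
    integral_semicircle]
  have := Real.pi_pos
  rw [one_div, inv_mul_cancel₀ (by positivity), ENNReal.ofReal_one]

/-- The semicircle distribution as a probability measure. -/
def semicircle : ProbabilityMeasure ℝ := ⟨semicircleMeasure, inferInstance⟩

/-- The semicircle law holds for `(X_n)` in probability: the empirical spectral distributions
converge weakly in probability to the semicircle distribution, that is, the integrals of every
bounded continuous function converge in probability. -/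
def SemicircleLawInProbability {Ω : Type*} [MeasurableSpace Ω] (μ : Measure Ω)
    (X : (n : ℕ) → Ω → Matrix (Fin n) (Fin n) ℝ) (hX : ∀ n ω, (X n ω).IsHermitian) : Prop :=
  ∀ f : ℝ →ᵇ ℝ, TendstoInMeasure μ
    (fun (n : ℕ) (ω : Ω) => ∫ x, f x ∂(esd (X n ω) (hX n ω) : Measure ℝ)) atTop
    (fun _ => ∫ x, f x ∂(semicircle : Measure ℝ))

/-- The semicircle law holds for `(X_n)` almost surely: almost surely, the empirical spectral
distributions converge weakly to the semicircle distribution. -/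
def SemicircleLawAlmostSurely {Ω : Type*} [MeasurableSpace Ω] (μ : Measure Ω)
    (X : (n : ℕ) → Ω → Matrix (Fin n) (Fin n) ℝ) (hX : ∀ n ω, (X n ω).IsHermitian) : Prop :=
  ∀ᵐ ω ∂μ, Tendsto (fun n : ℕ => esd (X n ω) (hX n ω)) atTop (𝓝 semicircle.toFiniteMeasure)

end

end BandMatrix

set_option linter.unusedSectionVars false

/-! The proof is the method of moments, with closed walks split into tree walks and the rest. Put β
= b_n^(-1/2). The k-th moment of σ_n is n⁻¹ β^k times the sum, over closed walks of length k through
relevant pairs, of the product of the entries along the walk. A tree walk explores a plane tree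
depth first and traverses each edge exactly twice.

For a family of walks with edge multiset L, (AU1) and n^(-1/2) ≤ β bound the weighted expectation by
a constant times β^(`excess L`), where `excess` is the length plus the number of simple edges. Each
new vertex raises the excess by at least 2 (`excess_add_le`), which pays for its at most b_n = β⁻²
choices. A closed walk from a fresh root that is not a tree walk raises it by at least one more
(`excess_add_lt`). Each such walk in an M-tuple therefore contributes O(nβ), whatever it shares with
the others, and the M-th moment of the non-tree part is O(b_n^(-M/2))
(`IsApproxUncorrelated.integral_nonTreePart_pow`). No independence and no centring is needed.

The number of tree walks is asymptotically n β^(-k) times the number of nonnegative ±1 excursions of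
length k (`tendsto_treeMean`), and these `ballot` numbers are the semicircle moments
(`integral_pow_semicircleMeasure`). By (AU2) the tree part concentrates around its count: in the
second moment, edge-disjoint pairs contribute only the constants C_n^(ℓ), and pairs sharing an edge
contribute O(1/(n b_n)) (`IsApproxUncorrelated.integral_treePart_sub_sq`).

Markov's inequality gives convergence of moments in probability. Under the hypotheses of ii), M = 2p
makes all bounds summable and Borel–Cantelli gives almost sure convergence. `exists_moments_close`
passes from finitely many moments to a bounded continuous function. -/

namespace BandMatrix

/-! ### Walks, the stack discipline and the excess. -/

section Walks

variable {V : Type*} [DecidableEq V]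

/-- The edges traversed by the walk that starts at `u` and visits the vertices of `l` in turn. -/
def edgeList : V → List V → List (Sym2 V)
  | _, [] => []
  | u, v :: l => s(u, v) :: edgeList v l

/-- The edges of a walk, as a multiset. -/
def edges (u : V) (l : List V) : Multiset (Sym2 V) := (edgeList u l : List (Sym2 V))

@[simp] lemma edges_nil (u : V) : edges u [] = 0 := rfl

@[simp] lemma edges_cons (u v : V) (l : List V) :
    edges u (v :: l) = s(u, v) ::ₘ edges v l := rfl

@[simp] lemma card_edges (u : V) (l : List V) : (edges u l).card = l.length := by
  induction l generalizing u with
  | nil => rfl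
  | cons v l ih => simp [ih]

lemma mem_of_mem_edges {u : V} {l : List V} {e : Sym2 V} (he : e ∈ edges u l) {x : V}
    (hx : x ∈ e) : x ∈ u :: l := by
  induction l generalizing u with
  | nil => simp at he
  | cons v l ih =>
    rw [edges_cons, Multiset.mem_cons] at he
    rcases he with rfl | he
    · rcases Sym2.mem_iff.1 hx with rfl | rfl <;> simp
    · exact List.mem_cons_of_mem _ (ih he)

/-- The number of elements of multiplicity one. -/
def simpleCount {α : Type*} [DecidableEq α] (L : Multiset α) : ℕ :=
  (L.toFinset.filter fun e => L.count e = 1).card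

/-- The cardinality of a multiset, with elements of multiplicity one counted twice. -/
def excess {α : Type*} [DecidableEq α] (L : Multiset α) : ℕ := L.card + simpleCount L

section Excess

variable {α : Type*} [DecidableEq α]

@[simp] lemma excess_zero : excess (0 : Multiset α) = 0 := by simp [excess, simpleCount]

/-- A first traversal of an edge adds to the length and creates a simple edge; a second adds to the
length but destroys the simple edge; any later one only adds to the length. The changes are 2, 0 and
1, in this and the next two lemmas. -/
lemma excess_cons_of_notMem {L : Multiset α} {e : α} (he : e ∉ L) :
    excess (e ::ₘ L) = excess L + 2 := by
  have : ((e ::ₘ L).toFinset.filter fun x => (e ::ₘ L).count x = 1)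
      = insert e (L.toFinset.filter fun x => L.count x = 1) := by
    ext x
    by_cases hx : x = e
    · subst hx; simp [Multiset.count_eq_zero.2 he]
    · simp [hx, Multiset.count_cons_of_ne]
  have h2 : e ∉ L.toFinset.filter fun x => L.count x = 1 := by simp [he]
  rw [excess, simpleCount, this, Finset.card_insert_of_notMem h2, Multiset.card_cons, excess,
    simpleCount]
  ring

lemma excess_cons_of_count_eq_one {L : Multiset α} {e : α} (he : L.count e = 1) :
    excess (e ::ₘ L) = excess L := by
  have hm : e ∈ L := Multiset.count_pos.1 (by omega)
  have : L.toFinset.filter (fun x => L.count x = 1)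
      = insert e ((e ::ₘ L).toFinset.filter fun x => (e ::ₘ L).count x = 1) := by
    ext x
    by_cases hx : x = e
    · subst hx; simp [he, hm]
    · simp [hx, Multiset.count_cons_of_ne]
  have h2 : e ∉ (e ::ₘ L).toFinset.filter fun x => (e ::ₘ L).count x = 1 := by simp [he]
  rw [excess, excess, simpleCount, simpleCount, this, Finset.card_insert_of_notMem h2,
    Multiset.card_cons]
  ring

lemma excess_cons_of_two_le_count {L : Multiset α} {e : α} (he : 2 ≤ L.count e) :
    excess (e ::ₘ L) = excess L + 1 := by
  have : L.toFinset.filter (fun x => L.count x = 1)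
      = (e ::ₘ L).toFinset.filter fun x => (e ::ₘ L).count x = 1 := by
    ext x
    by_cases hx : x = e
    · subst hx
      simp only [Finset.mem_filter, Multiset.count_cons_self]
      omega
    · simp [hx, Multiset.count_cons_of_ne]
  rw [excess, excess, simpleCount, simpleCount, this, Multiset.card_cons]
  ring

lemma excess_le_cons (L : Multiset α) (e : α) : excess L ≤ excess (e ::ₘ L) := by
  rcases Nat.lt_or_ge (L.count e) 2 with h | h
  · interval_cases h' : L.count e
    · rw [excess_cons_of_notMem (Multiset.count_eq_zero.1 h')]; omega
    · rw [excess_cons_of_count_eq_one h']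
  · rw [excess_cons_of_two_le_count h]; omega

end Excess

/-- The number of vertices of `l` outside `O`. -/
def newCount (O : Finset V) (l : List V) : ℕ := (l.toFinset \ O).card

@[simp] lemma newCount_nil (O : Finset V) : newCount O [] = 0 := by simp [newCount]

lemma newCount_cons_of_mem {O : Finset V} {v : V} (hv : v ∈ O) (l : List V) :
    newCount O (v :: l) = newCount O l := by
  simp [newCount, Finset.insert_sdiff_of_mem _ hv]

lemma newCount_cons_of_notMem {O : Finset V} {v : V} (hv : v ∉ O) (l : List V) :
    newCount O (v :: l) = newCount (insert v O) l + 1 := by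
  have : (v :: l).toFinset \ O = insert v (l.toFinset \ insert v O) := by
    ext x
    by_cases hx : x = v
    · subst hx; simp [hv]
    · simp [hx]
  rw [newCount, this, Finset.card_insert_of_notMem (by simp), newCount]

/-- All endpoints of the edges in `L` lie in `O`. -/
def Supported (O : Finset V) (L : Multiset (Sym2 V)) : Prop := ∀ e ∈ L, ∀ x ∈ e, x ∈ O

lemma Supported.mono {O O' : Finset V} {L : Multiset (Sym2 V)} (h : Supported O L)
    (hO : O ⊆ O') : Supported O' L := fun e he x hx => hO (h e he x hx)

lemma Supported.cons {O : Finset V} {L : Multiset (Sym2 V)} (h : Supported O L) {u v : V}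
    (hu : u ∈ O) (hv : v ∈ O) : Supported O (s(u, v) ::ₘ L) := by
  intro e he x hx
  rcases Multiset.mem_cons.1 he with rfl | he
  · rcases Sym2.mem_iff.1 hx with rfl | rfl <;> assumption
  · exact h e he x hx

lemma Supported.notMem {O : Finset V} {L : Multiset (Sym2 V)} (h : Supported O L) {u v : V}
    (hv : v ∉ O) : s(u, v) ∉ L := fun hm => hv (h _ hm _ (Sym2.mem_mk_right u v))

lemma supported_edges_add {O : Finset V} {L : Multiset (Sym2 V)} (h : Supported O L) (u : V)
    (l : List V) : Supported (O ∪ (u :: l).toFinset) (edges u l + L) := by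
  intro e he x hx
  rw [Finset.mem_union, List.mem_toFinset]
  rcases Multiset.mem_add.1 he with he | he
  · exact Or.inr (mem_of_mem_edges he hx)
  · exact Or.inl (h e he x hx)

lemma edges_cons_add (u v : V) (l : List V) (L : Multiset (Sym2 V)) :
    edges u (v :: l) + L = edges v l + s(u, v) ::ₘ L := by
  rw [edges_cons, Multiset.cons_add, Multiset.add_cons]

/-- No step lowers the excess, and a step to a vertex outside `O` uses an edge that cannot lie in
`L`, which gains 2. -/
lemma excess_add_le (l : List V) {u : V} {O : Finset V} {L : Multiset (Sym2 V)}
    (hL : Supported O L) (hu : u ∈ O) :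
    excess L + 2 * newCount O l ≤ excess (edges u l + L) := by
  induction l generalizing u O L with
  | nil => simp
  | cons v l ih =>
    rw [edges_cons_add]
    by_cases hv : v ∈ O
    · rw [newCount_cons_of_mem hv]
      have := ih (hL.cons hu hv) hv
      have := excess_le_cons L s(u, v)
      omega
    · have h1 := ih ((hL.mono (Finset.subset_insert v O)).cons
        (Finset.mem_insert_of_mem hu) (Finset.mem_insert_self v O)) (Finset.mem_insert_self v O)
      rw [excess_cons_of_notMem (hL.notMem hv)] at h1
      rw [newCount_cons_of_notMem hv]
      omega

/-- The walk `l` obeys the stack discipline: starting with the stack `st` and the set `O` of visited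
vertices, each step either pushes an unvisited vertex or pops the top of the stack, and in the end
one vertex is left on the stack. -/
def Stacked : List V → Finset V → List V → Prop
  | st, _, [] => st.length = 1
  | st, O, v :: l => (v ∉ O ∧ Stacked (v :: st) (insert v O) l) ∨
      (v ∈ O ∧ ∃ u tl, st = u :: v :: tl ∧ Stacked (v :: tl) O l)

/-- The edges of the path formed by a stack. -/
def stackEdges : List V → List (Sym2 V)
  | [] => []
  | u :: l => edgeList u l

lemma mem_of_mem_stackEdges {st : List V} {e : Sym2 V} (he : e ∈ stackEdges st) {x : V}
    (hx : x ∈ e) : x ∈ st := by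
  cases st with
  | nil => simp [stackEdges] at he
  | cons u l => exact mem_of_mem_edges (u := u) (l := l) he hx

lemma stackEdges_cons_cons (u v : V) (l : List V) :
    stackEdges (u :: v :: l) = s(u, v) :: stackEdges (v :: l) := rfl

/-- A closed walk that starts at a fresh vertex and violates the stack discipline has a
strictly larger excess than the number of its new vertices accounts for. -/
lemma excess_add_lt (l : List V) {u : V} {tl : List V} {O : Finset V} {L : Multiset (Sym2 V)}
    (hL : Supported O L) (hnd : (u :: tl).Nodup) (hO : ∀ x ∈ u :: tl, x ∈ O)
    (hst : ∀ x ∈ u :: tl, ∀ y, L.count s(x, y) = 1 → s(x, y) ∈ stackEdges (u :: tl))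
    (hend : (u :: l).getLast (by simp) = (u :: tl).getLast (by simp))
    (hbad : ¬ Stacked (u :: tl) O l) :
    excess L + 2 * newCount O l + 1 ≤ excess (edges u l + L) := by
  induction l generalizing u tl O L with
  -- A finished walk stands at the bottom of the stack, and a stack without repetitions whose top is
  -- its bottom has length one.
  | nil =>
    exfalso
    apply hbad
    cases tl with
    | nil => simp [Stacked]
    | cons v tl =>
      simp only [List.getLast_singleton, List.getLast_cons_cons] at hend
      exact absurd (hend ▸ List.getLast_mem (by simp)) (List.nodup_cons.1 hnd).1
  | cons v l ih =>
    have hu : u ∈ O := hO u (by simp)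
    rw [edges_cons_add]
    rw [List.getLast_cons_cons] at hend
    simp only [Stacked, not_or, not_and] at hbad
    by_cases hv : v ∈ O
    · rw [newCount_cons_of_mem hv]
      have h1 := excess_add_le l (hL.cons hu hv) hv
      -- A step back to a visited vertex gains at once, unless it repeats a simple edge. By `hst`
      -- that edge is on the stack, and since `u` is not repeated it is the top edge: the step is a
      -- legal pop, so the violation comes later and induction applies.
      rcases Nat.lt_or_ge (L.count s(u, v)) 2 with h | h
      · interval_cases h' : L.count s(u, v)
        · rw [excess_cons_of_notMem (Multiset.count_eq_zero.1 h')] at h1; omega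
        · have hs := hst u (by simp) v h'
          obtain ⟨tl', rfl⟩ : ∃ tl', tl = v :: tl' := by
            cases tl with
            | nil => simp [stackEdges, edgeList] at hs
            | cons w tl =>
              rw [stackEdges_cons_cons, List.mem_cons] at hs
              rcases hs with hs | hs
              · exact ⟨tl, by rw [Sym2.congr_right.1 hs]⟩
              · exact absurd (mem_of_mem_stackEdges hs (Sym2.mem_mk_left u v))
                  (List.nodup_cons.1 hnd).1
          have hu' : u ∉ v :: tl' := (List.nodup_cons.1 hnd).1
          have := ih (u := v) (tl := tl') (hL.cons hu hv) (List.nodup_cons.1 hnd).2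
            (fun x hx => hO x (List.mem_cons_of_mem _ hx)) (by
              intro x hx y hxy
              by_cases he : s(x, y) = s(u, v)
              · rw [he, Multiset.count_cons_self] at hxy; omega
              · rw [Multiset.count_cons_of_ne he] at hxy
                have := hst x (List.mem_cons_of_mem _ hx) y hxy
                rw [stackEdges_cons_cons, List.mem_cons] at this
                exact this.resolve_left he)
            (by rw [hend, List.getLast_cons_cons])
            (hbad.2 hv |> fun h hs => h ⟨u, tl', rfl, hs⟩)
          rwa [excess_cons_of_count_eq_one h'] at this
      · rw [excess_cons_of_two_le_count h] at h1; omega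
    · rw [newCount_cons_of_notMem hv]
      have hnm := hL.notMem (u := u) hv
      have hv' : v ∉ u :: tl := fun h => hv (hO v h)
      have := ih (u := v) (tl := u :: tl) (O := insert v O) (L := s(u, v) ::ₘ L)
        ((hL.mono (Finset.subset_insert v O)).cons
        (Finset.mem_insert_of_mem hu) (Finset.mem_insert_self v O))
        (List.nodup_cons.2 ⟨hv', hnd⟩)
        (fun x hx => by
          rcases List.mem_cons.1 hx with rfl | hx
          · exact Finset.mem_insert_self _ _
          · exact Finset.mem_insert_of_mem (hO x hx))
        (by
          intro x hx y hxy
          rw [stackEdges_cons_cons, List.mem_cons]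
          by_cases he : s(x, y) = s(u, v)
          · left; rw [he, Sym2.eq_swap]
          · right
            rw [Multiset.count_cons_of_ne he] at hxy
            rcases List.mem_cons.1 hx with rfl | hx
            · have : s(x, y) ∈ L := Multiset.count_pos.1 (by omega)
              exact absurd (hL _ this x (Sym2.mem_mk_left x y)) hv
            · exact hst x hx y hxy)
        (by rw [hend, List.getLast_cons_cons])
        (hbad.1 hv)
      rw [excess_cons_of_notMem hnm] at this
      omega

/-- A walk that obeys the stack discipline traverses each of its edges exactly twice. -/
lemma count_edges_of_stacked (l : List V) {u : V} {tl : List V} {O : Finset V}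
    {L : Multiset (Sym2 V)} (hL : Supported O L) (hnd : (u :: tl).Nodup)
    (hO : ∀ x ∈ u :: tl, x ∈ O)
    (h1 : ∀ e ∈ stackEdges (u :: tl), L.count e = 1)
    (h2 : ∀ e ∈ L, e ∉ stackEdges (u :: tl) → L.count e = 2)
    (hs : Stacked (u :: tl) O l) :
    ∀ e ∈ edges u l + L, (edges u l + L).count e = 2 := by
  induction l generalizing u tl O L with
  | nil =>
    have : tl = [] := by simpa [Stacked] using hs
    subst this
    intro e he
    simpa using h2 e (by simpa using he) (by simp [stackEdges, edgeList])
  | cons v l ih =>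
    have hu : u ∈ O := hO u (by simp)
    rw [edges_cons_add]
    rcases hs with ⟨hv, hs⟩ | ⟨hv, u', tl', heq, hs⟩
    · have hnm := hL.notMem (u := u) hv
      have hv' : v ∉ u :: tl := fun h => hv (hO v h)
      refine ih ((hL.mono (Finset.subset_insert v O)).cons
        (Finset.mem_insert_of_mem hu) (Finset.mem_insert_self v O))
        (List.nodup_cons.2 ⟨hv', hnd⟩)
        (fun x hx => by
          rcases List.mem_cons.1 hx with rfl | hx
          · exact Finset.mem_insert_self _ _
          · exact Finset.mem_insert_of_mem (hO x hx)) ?_ ?_ hs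
      · intro e he
        rw [stackEdges_cons_cons, List.mem_cons, Sym2.eq_swap] at he
        rcases he with rfl | he
        · rw [Multiset.count_cons_self, Multiset.count_eq_zero.2 hnm]
        · have hne : e ≠ s(u, v) := by
            rintro rfl
            exact hv' (mem_of_mem_stackEdges he (Sym2.mem_mk_right u v))
          rw [Multiset.count_cons_of_ne hne, h1 e he]
      · intro e he hne
        rw [stackEdges_cons_cons, List.mem_cons, Sym2.eq_swap, not_or] at hne
        rw [Multiset.count_cons_of_ne hne.1]
        exact h2 e ((Multiset.mem_cons.1 he).resolve_left hne.1) hne.2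
    · obtain ⟨rfl, rfl⟩ : u = u' ∧ tl = v :: tl' := by simpa using heq
      have hu' : u ∉ v :: tl' := (List.nodup_cons.1 hnd).1
      have h3 : s(u, v) ∉ stackEdges (v :: tl') := fun h =>
        hu' (mem_of_mem_stackEdges h (Sym2.mem_mk_left u v))
      have h4 := h1 s(u, v) (by simp [stackEdges_cons_cons])
      refine ih (hL.cons hu hv) (List.nodup_cons.1 hnd).2
        (fun x hx => hO x (List.mem_cons_of_mem _ hx)) ?_ ?_ hs
      · intro e he
        have hne : e ≠ s(u, v) := by rintro rfl; exact h3 he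
        rw [Multiset.count_cons_of_ne hne]
        exact h1 e (by rw [stackEdges_cons_cons]; exact List.mem_cons_of_mem _ he)
      · intro e he hne
        by_cases heq : e = s(u, v)
        · rw [heq, Multiset.count_cons_self, h4]
        · rw [Multiset.count_cons_of_ne heq]
          refine h2 e ((Multiset.mem_cons.1 he).resolve_left heq) ?_
          rw [stackEdges_cons_cons, List.mem_cons, not_or]
          exact ⟨heq, hne⟩

/-- A walk that obeys the stack discipline ends at the bottom of the stack. -/
lemma getLast_of_stacked (l : List V) {u : V} {tl : List V} {O : Finset V}
    (hs : Stacked (u :: tl) O l) :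
    (u :: l).getLast (by simp) = (u :: tl).getLast (by simp) := by
  induction l generalizing u tl O with
  | nil =>
    have : tl = [] := by simpa [Stacked] using hs
    simp [this]
  | cons v l ih =>
    rw [List.getLast_cons_cons]
    rcases hs with ⟨hv, hs⟩ | ⟨hv, u', tl', heq, hs⟩
    · rw [ih hs, List.getLast_cons_cons]
    · obtain ⟨rfl, rfl⟩ : u = u' ∧ tl = v :: tl' := by simpa using heq
      rw [ih hs, List.getLast_cons_cons]

/-- The walk `l` from `r` explores a plane tree, depth first. -/
def IsTreeWalk (r : V) (l : List V) : Prop := Stacked [r] {r} l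

lemma IsTreeWalk.count_edges {r : V} {l : List V} (h : IsTreeWalk r l) {e : Sym2 V}
    (he : e ∈ edges r l) : (edges r l).count e = 2 := by
  simpa using count_edges_of_stacked l (L := 0) (by simp [Supported]) (by simp) (by simp)
    (by simp [stackEdges, edgeList]) (by simp) h e (by simpa using he)

lemma IsTreeWalk.getLast_eq {r : V} {l : List V} (h : IsTreeWalk r l) :
    (r :: l).getLast (by simp) = r := getLast_of_stacked l h

lemma two_mul_card_toFinset {α : Type*} [DecidableEq α] {L : Multiset α}
    (h : ∀ e ∈ L, L.count e = 2) : 2 * L.toFinset.card = L.card := by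
  rw [← Multiset.toFinset_sum_count_eq, Finset.sum_congr rfl
    (fun e he => h e (Multiset.mem_toFinset.1 he))]
  simp [mul_comm]

/-- No edge of a tree walk is simple, so its excess is its length. -/
lemma IsTreeWalk.newCount_le {r : V} {l : List V} (h : IsTreeWalk r l) :
    2 * newCount {r} l ≤ l.length := by
  have h1 := excess_add_le l (L := 0) (O := {r}) (u := r) (by simp [Supported]) (by simp)
  have h2 : simpleCount (edges r l) = 0 := by
    rw [simpleCount, Finset.card_eq_zero, Finset.filter_eq_empty_iff]
    intro e he
    rw [h.count_edges (Multiset.mem_toFinset.1 he)]; omega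
  simp only [add_zero, excess, h2, card_edges] at h1
  simpa [simpleCount] using h1

/-- Vertices visited by earlier walks can be forgotten: shrinking `O` makes pushes easier, and the
target of a pop lies on the stack anyway. -/
lemma Stacked.mono (l : List V) {st : List V} {O O' : Finset V} (hs : Stacked st O l)
    (hO : O' ⊆ O) (hst : ∀ x ∈ st, x ∈ O') : Stacked st O' l := by
  induction l generalizing st O O' with
  | nil => exact hs
  | cons v l ih =>
    rcases hs with ⟨hv, hs⟩ | ⟨hv, u, tl, rfl, hs⟩
    · refine Or.inl ⟨fun h => hv (hO h), ih hs (Finset.insert_subset_insert v hO) ?_⟩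
      intro x hx
      rcases List.mem_cons.1 hx with rfl | hx
      · exact Finset.mem_insert_self _ _
      · exact Finset.mem_insert_of_mem (hst x hx)
    · exact Or.inr ⟨hst v (by simp), u, tl, rfl,
        ih hs hO fun x hx => hst x (List.mem_cons_of_mem _ hx)⟩

/-- A closed walk from a fresh vertex that is not a tree walk has a strictly larger excess than
the number of its new vertices accounts for. -/
lemma excess_of_not_isTreeWalk {r : V} {l : List V} {O : Finset V} {L : Multiset (Sym2 V)}
    (hL : Supported O L) (hr : r ∉ O) (hend : (r :: l).getLast (by simp) = r)
    (hbad : ¬ IsTreeWalk r l) :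
    excess L + 2 * newCount (insert r O) l + 1 ≤ excess (edges r l + L) := by
  refine excess_add_lt l (tl := []) (hL.mono (Finset.subset_insert r O)) (by simp) (by simp) ?_
    (by simpa using hend) fun hs => hbad (hs.mono l (by simp) (by simp))
  intro x hx y hxy
  obtain rfl : x = r := by simpa using hx
  exact absurd (hL _ (Multiset.count_pos.1 (by omega)) x (Sym2.mem_mk_left x y)) hr

end Walks
-- Expansion of powers of sums.
section Lists

variable {α : Type*}

/-- The lists of length `k` with entries in `s`. -/
def listsOf (s : Finset α) : ℕ → Finset (List α)
  | 0 => {[]}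
  | k + 1 => (s ×ˢ listsOf s k).map
      ⟨fun p => p.1 :: p.2, fun _ _ h => Prod.ext (List.cons.inj h).1 (List.cons.inj h).2⟩

lemma sum_listsOf_succ {β : Type*} [AddCommMonoid β] (s : Finset α) (k : ℕ) (F : List α → β) :
    ∑ l ∈ listsOf s (k + 1), F l = ∑ v ∈ s, ∑ l ∈ listsOf s k, F (v :: l) := by
  rw [listsOf, Finset.sum_map, Finset.sum_product]
  rfl

lemma mem_listsOf {s : Finset α} {k : ℕ} {l : List α} :
    l ∈ listsOf s k ↔ l.length = k ∧ ∀ x ∈ l, x ∈ s := by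
  induction k generalizing l with
  | zero => simp +contextual [listsOf, List.length_eq_zero_iff]
  | succ k ih =>
    cases l with
    | nil => simp [listsOf]
    | cons v l =>
      simp only [listsOf, Finset.mem_map, Finset.mem_product, ih, Prod.exists,
        List.length_cons, Nat.add_right_cancel_iff,
        List.mem_cons, forall_eq_or_imp]
      constructor
      · rintro ⟨_, _, h, heq⟩
        obtain ⟨rfl, rfl⟩ := List.cons.inj heq
        exact ⟨h.2.1, h.1, h.2.2⟩
      · exact fun h => ⟨v, l, ⟨h.2.1, h.1, h.2.2⟩, rfl⟩

lemma sum_pow_eq_sum_listsOf {R : Type*} [CommSemiring R] (s : Finset α) (f : α → R) (M : ℕ) :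
    (∑ a ∈ s, f a) ^ M = ∑ l ∈ listsOf s M, (l.map f).prod := by
  induction M with
  | zero => simp [listsOf]
  | succ M ih =>
    rw [pow_succ', ih, sum_listsOf_succ, Finset.sum_mul_sum]
    simp

end Lists

/-! ### Weighted sums over walks that are not tree walks. -/

section Paths

variable {V : Type*} [Fintype V] [DecidableEq V] (rel : V → V → Prop)

open Classical in
/-- The neighbours of `u`. -/
noncomputable def nbrs (u : V) : Finset V := Finset.univ.filter (rel u)

open Classical in
/-- The paths of length `k` that start at `u`. -/
noncomputable def paths (k : ℕ) (u : V) : Finset (List V) :=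
  (listsOf Finset.univ k).filter fun l => (u :: l).IsChain rel

lemma mem_paths {k : ℕ} {u : V} {l : List V} :
    l ∈ paths rel k u ↔ l.length = k ∧ (u :: l).IsChain rel := by
  simp [paths, mem_listsOf]

lemma paths_zero (u : V) : paths rel 0 u = {[]} := by
  ext l
  rw [mem_paths, List.length_eq_zero_iff, Finset.mem_singleton]
  exact ⟨fun h => h.1, by rintro rfl; simp⟩

lemma sum_paths_succ {β : Type*} [AddCommMonoid β] (k : ℕ) (u : V) (F : List V → β) :
    ∑ l ∈ paths rel (k + 1) u, F l
      = ∑ v ∈ nbrs rel u, ∑ l ∈ paths rel k v, F (v :: l) := by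
  classical
  simp only [paths, nbrs, Finset.sum_filter]
  rw [sum_listsOf_succ]
  refine Finset.sum_congr rfl fun v _ => ?_
  by_cases h : rel u v
  · simp [h]
  · simp [h]

open Classical in
/-- The closed walks of length `k` that are tree walks. -/
noncomputable def treeWalks (k : ℕ) : Finset (Σ _ : V, List V) :=
  Finset.univ.sigma fun r => (paths rel k r).filter fun l => IsTreeWalk r l

open Classical in
/-- The closed walks of length `k` that are not tree walks. -/
noncomputable def nonTreeWalks (k : ℕ) : Finset (Σ _ : V, List V) :=
  Finset.univ.sigma fun r => (paths rel k r).filter fun l =>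
    (r :: l).getLast (by simp) = r ∧ ¬ IsTreeWalk r l

open Classical in
lemma sum_closed_paths (k : ℕ) (F : V → List V → ℝ) :
    ∑ r, ∑ l ∈ (paths rel k r).filter (fun l => (r :: l).getLast (by simp) = r), F r l
      = ∑ w ∈ treeWalks rel k, F w.1 w.2 + ∑ w ∈ nonTreeWalks rel k, F w.1 w.2 := by
  rw [treeWalks, nonTreeWalks, Finset.sum_sigma, Finset.sum_sigma, ← Finset.sum_add_distrib]
  refine Finset.sum_congr rfl fun r _ => ?_
  rw [← Finset.sum_filter_add_sum_filter_not _ (fun l => IsTreeWalk r l), Finset.filter_filter,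
    Finset.filter_filter]
  congr 1
  refine Finset.sum_congr ?_ fun _ _ => rfl
  refine Finset.filter_congr fun l _ => ?_
  exact ⟨fun h => h.2, fun h => ⟨h.getLast_eq, h⟩⟩

variable {rel}

/-- A step into `O` has at most `O.card` targets. A step to a new vertex has at most `1 / c`
targets, each of weight `c`. So a step costs a factor of at most `O.card + 1`, and `O` grows by at
most one vertex per step. -/
lemma sum_pow_newCount_le {c : ℝ} (hc : 0 ≤ c) (hdeg : ∀ u, c * (nbrs rel u).card ≤ 1) (k : ℕ)
    (u : V) (O : Finset V) :
    ∑ l ∈ paths rel k u, c ^ newCount O l ≤ ((O.card : ℝ) + k + 1) ^ k := by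
  induction k generalizing u O with
  | zero => simp [paths_zero]
  | succ k ih =>
    rw [sum_paths_succ, ← Finset.sum_filter_add_sum_filter_not _ (fun v => v ∈ O)]
    have h1 : ∑ v ∈ (nbrs rel u).filter (fun v => v ∈ O), ∑ l ∈ paths rel k v,
        c ^ newCount O (v :: l) ≤ O.card * ((O.card : ℝ) + (k + 1 : ℕ) + 1) ^ k := by
      calc _ ≤ ∑ v ∈ (nbrs rel u).filter (fun v => v ∈ O),
            ((O.card : ℝ) + (k + 1 : ℕ) + 1) ^ k := by
            refine Finset.sum_le_sum fun v hv => ?_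
            rw [Finset.mem_filter] at hv
            simp only [newCount_cons_of_mem hv.2]
            refine (ih v O).trans ?_
            gcongr
            linarith
        _ ≤ _ := by
            rw [Finset.sum_const, nsmul_eq_mul]
            gcongr
            exact fun v hv => (Finset.mem_filter.1 hv).2
    have h2 : ∑ v ∈ (nbrs rel u).filter (fun v => v ∉ O), ∑ l ∈ paths rel k v,
        c ^ newCount O (v :: l) ≤ 1 * ((O.card : ℝ) + (k + 1 : ℕ) + 1) ^ k := by
      calc _ ≤ ∑ v ∈ (nbrs rel u).filter (fun v => v ∉ O),
            c * ((O.card : ℝ) + (k + 1 : ℕ) + 1) ^ k := by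
            refine Finset.sum_le_sum fun v hv => ?_
            rw [Finset.mem_filter] at hv
            simp only [newCount_cons_of_notMem hv.2, pow_succ']
            rw [← Finset.mul_sum]
            gcongr
            refine (ih v _).trans ?_
            rw [Finset.card_insert_of_notMem hv.2]
            push_cast
            gcongr ?_ ^ k
            linarith
        _ ≤ (c * (nbrs rel u).card) * ((O.card : ℝ) + (k + 1 : ℕ) + 1) ^ k := by
            rw [Finset.sum_const, nsmul_eq_mul, mul_left_comm, mul_assoc]
            gcongr
            exact Finset.filter_subset _ _
        _ ≤ _ := by gcongr; exact hdeg u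
    refine (add_le_add h1 h2).trans ?_
    rw [← add_mul, pow_succ']
    push_cast
    gcongr
    linarith [(Nat.cast_nonneg k : (0:ℝ) ≤ k)]

/-- The edges of several walks, as a multiset. -/
def totalEdges (ws : List (Σ _ : V, List V)) : Multiset (Sym2 V) :=
  (ws.map fun w => edges w.1 w.2).sum

/-- A fresh root has at most `Fintype.card V` choices and wins a factor `β` from
`excess_of_not_isTreeWalk`. A root in `O` wins nothing but has at most `N` choices, and
`Fintype.card V * β ≥ 1` absorbs them. -/
lemma sum_nonTreeWalks_le {β : ℝ} (h0 : 0 < β) (h1 : β ≤ 1)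
    (hdeg : ∀ u, β ^ 2 * (nbrs rel u).card ≤ 1) (hn : 1 ≤ Fintype.card V * β ^ 2) (k : ℕ)
    {O : Finset V} {L : Multiset (Sym2 V)} (hL : Supported O L) {N : ℕ}
    (hN : O.card + k + 1 ≤ N) :
    ∑ w ∈ nonTreeWalks rel k, β ^ excess (edges w.1 w.2 + L)
      ≤ Fintype.card V * β * ((N : ℝ) + 1) ^ (k + 1) * β ^ excess L := by
  classical
  rw [nonTreeWalks, Finset.sum_sigma]
  have hsub : ∀ r : V, ((paths rel k r).filter fun l => (r :: l).getLast (by simp) = r ∧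
      ¬ IsTreeWalk r l) ⊆ paths rel k r := fun r => Finset.filter_subset _ _
  have hN' : (O.card : ℝ) + k + 1 ≤ N := by exact_mod_cast hN
  have hfresh : ∀ r ∉ O, ∑ l ∈ ((paths rel k r).filter fun l =>
      (r :: l).getLast (by simp) = r ∧ ¬ IsTreeWalk r l), β ^ excess (edges r l + L)
      ≤ β * ((N : ℝ) + 1) ^ k * β ^ excess L := by
    intro r hr
    calc _ ≤ ∑ l ∈ ((paths rel k r).filter fun l =>
          (r :: l).getLast (by simp) = r ∧ ¬ IsTreeWalk r l),
          (β ^ 2) ^ newCount (insert r O) l * (β * β ^ excess L) := by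
          refine Finset.sum_le_sum fun l hl => ?_
          rw [Finset.mem_filter] at hl
          have := excess_of_not_isTreeWalk hL hr hl.2.1 hl.2.2
          refine (pow_le_pow_of_le_one h0.le h1 this).trans (le_of_eq ?_)
          rw [← pow_mul]
          ring
      _ ≤ ∑ l ∈ paths rel k r, (β ^ 2) ^ newCount (insert r O) l * (β * β ^ excess L) :=
          Finset.sum_le_sum_of_subset_of_nonneg (hsub r) fun _ _ _ => by positivity
      _ ≤ ((N : ℝ) + 1) ^ k * (β * β ^ excess L) := by
          rw [← Finset.sum_mul]
          gcongr
          refine (sum_pow_newCount_le (by positivity) hdeg k r _).trans ?_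
          rw [Finset.card_insert_of_notMem hr]
          gcongr
          push_cast
          linarith
      _ = _ := by ring
  have hold : ∀ r ∈ O, ∑ l ∈ ((paths rel k r).filter fun l =>
      (r :: l).getLast (by simp) = r ∧ ¬ IsTreeWalk r l), β ^ excess (edges r l + L)
      ≤ ((N : ℝ) + 1) ^ k * β ^ excess L := by
    intro r hr
    calc _ ≤ ∑ l ∈ paths rel k r, β ^ excess (edges r l + L) :=
          Finset.sum_le_sum_of_subset_of_nonneg (hsub r) fun _ _ _ => by positivity
      _ ≤ ∑ l ∈ paths rel k r, (β ^ 2) ^ newCount O l * β ^ excess L := by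
          refine Finset.sum_le_sum fun l hl => ?_
          refine (pow_le_pow_of_le_one h0.le h1 (excess_add_le l hL hr)).trans (le_of_eq ?_)
          rw [← pow_mul]
          ring
      _ ≤ _ := by
          rw [← Finset.sum_mul]
          gcongr
          refine (sum_pow_newCount_le (by positivity) hdeg k r _).trans ?_
          gcongr
          linarith
  have hnb : 1 ≤ Fintype.card V * β := hn.trans (by
    have : β ^ 2 ≤ β := by nlinarith
    gcongr)
  rw [← Finset.sum_filter_add_sum_filter_not _ (fun r => r ∈ O)]
  calc _ ≤ ∑ r ∈ Finset.univ.filter (fun r => r ∈ O), ((N : ℝ) + 1) ^ k * β ^ excess L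
        + ∑ r ∈ Finset.univ.filter (fun r => r ∉ O), β * ((N : ℝ) + 1) ^ k * β ^ excess L := by
        gcongr with r hr r hr
        · exact hold r (Finset.mem_filter.1 hr).2
        · exact hfresh r (Finset.mem_filter.1 hr).2
    _ ≤ N * (((N : ℝ) + 1) ^ k * β ^ excess L)
        + Fintype.card V * (β * ((N : ℝ) + 1) ^ k * β ^ excess L) := by
        rw [Finset.sum_const, Finset.sum_const, nsmul_eq_mul, nsmul_eq_mul]
        gcongr
        · simp only [Finset.filter_univ_mem]; omega
        · exact Finset.card_le_univ _
    _ ≤ N * (((N : ℝ) + 1) ^ k * β ^ excess L) * (Fintype.card V * β)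
        + Fintype.card V * (β * ((N : ℝ) + 1) ^ k * β ^ excess L) := by
        refine add_le_add ?_ le_rfl
        exact le_mul_of_one_le_right (by positivity) hnb
    _ = _ := by ring

/-- The walks are added one at a time, with `L` holding the edges already used, so edges shared
between walks are counted correctly. `N` bounds the vertices of `M` walks together with `O`. -/
lemma sum_lists_nonTreeWalks_le {β : ℝ} (h0 : 0 < β) (h1 : β ≤ 1)
    (hdeg : ∀ u, β ^ 2 * (nbrs rel u).card ≤ 1) (hn : 1 ≤ Fintype.card V * β ^ 2) (k : ℕ)
    {N M : ℕ} {O : Finset V} {L : Multiset (Sym2 V)} (hL : Supported O L)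
    (hN : O.card + M * (k + 1) ≤ N) :
    ∑ ws ∈ listsOf (nonTreeWalks rel k) M, β ^ excess (totalEdges ws + L)
      ≤ (Fintype.card V * β * ((N : ℝ) + 1) ^ (k + 1)) ^ M * β ^ excess L := by
  induction M generalizing O L with
  | zero => simp [listsOf, totalEdges]
  | succ M ih =>
    rw [sum_listsOf_succ]
    calc _ ≤ ∑ w ∈ nonTreeWalks rel k,
          (Fintype.card V * β * ((N : ℝ) + 1) ^ (k + 1)) ^ M * β ^ excess (edges w.1 w.2 + L) := by
          refine Finset.sum_le_sum fun w hw => ?_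
          have hlen : w.2.length = k := by
            classical
            rw [nonTreeWalks, Finset.mem_sigma, Finset.mem_filter, mem_paths] at hw
            exact hw.2.1.1
          have := ih (supported_edges_add hL w.1 w.2) (by
            have h3 := Finset.card_union_le O (w.1 :: w.2).toFinset
            have h4 := (w.1 :: w.2).toFinset_card_le
            rw [List.length_cons, hlen] at h4
            have : (M + 1) * (k + 1) = M * (k + 1) + (k + 1) := by ring
            omega)
          refine le_trans (le_of_eq ?_) this
          refine Finset.sum_congr rfl fun ws _ => ?_
          congr 2
          simp only [totalEdges, List.map_cons, List.sum_cons]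
          abel
      _ ≤ (Fintype.card V * β * ((N : ℝ) + 1) ^ (k + 1)) ^ M *
          (Fintype.card V * β * ((N : ℝ) + 1) ^ (k + 1) * β ^ excess L) := by
          rw [← Finset.mul_sum]
          gcongr
          refine sum_nonTreeWalks_le h0 h1 hdeg hn k hL ?_
          have : (M + 1) * (k + 1) = M * (k + 1) + (k + 1) := by ring
          omega
      _ = _ := by ring

end Paths
-- Counting tree walks and pairs of tree walks sharing an edge.
/-- The number of nonnegative `±1`-paths of `r` steps that start at height `h` and end at `0`. -/
def ballot : ℕ → ℕ → ℕ
  | 0, 0 => 1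
  | 0, _ + 1 => 0
  | r + 1, 0 => ballot r 1
  | r + 1, h + 1 => ballot r (h + 2) + ballot r h

lemma ballot_le (r h : ℕ) : ballot r h ≤ 2 ^ r := by
  induction r generalizing h with
  | zero => cases h <;> simp [ballot]
  | succ r ih =>
    have : 2 ^ (r + 1) = 2 ^ r + 2 ^ r := by ring
    cases h with
    | zero => rw [ballot, this]; exact (ih 1).trans (Nat.le_add_right _ _)
    | succ h => rw [ballot, this]; exact add_le_add (ih _) (ih _)

section Count

variable {V : Type*} [Fintype V] [DecidableEq V] (rel : V → V → Prop)

open Classical in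
/-- The number of walks of length `k` from `u` that complete the stack `u :: tl`. -/
noncomputable def stackedCount (k : ℕ) (u : V) (tl : List V) (O : Finset V) : ℕ :=
  ((paths rel k u).filter fun l => Stacked (u :: tl) O l).card

lemma stackedCount_zero (u : V) (tl : List V) (O : Finset V) :
    stackedCount rel 0 u tl O = ballot 0 tl.length := by
  cases tl <;> simp [stackedCount, paths_zero, Finset.filter_singleton, Stacked, ballot]

lemma stackedCount_succ (k : ℕ) (u : V) (tl : List V) (O : Finset V) :
    stackedCount rel (k + 1) u tl O =
      ∑ v ∈ (nbrs rel u).filter (fun v => v ∉ O), stackedCount rel k v (u :: tl) (insert v O)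
      + ∑ v ∈ (nbrs rel u).filter (fun v => v ∈ O),
        if tl.head? = some v then stackedCount rel k v tl.tail O else 0 := by
  classical
  simp only [stackedCount, Finset.card_filter]
  rw [sum_paths_succ, ← Finset.sum_filter_add_sum_filter_not _ (fun v => v ∉ O)]
  congr 1
  · refine Finset.sum_congr rfl fun v hv => Finset.sum_congr rfl fun l _ => ?_
    have hv := (Finset.mem_filter.1 hv).2
    simp [Stacked, hv]
  · simp only [not_not]
    refine Finset.sum_congr rfl fun v hv => ?_
    have hv := (Finset.mem_filter.1 hv).2
    split_ifs with h
    · refine Finset.sum_congr rfl fun l _ => ?_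
      obtain ⟨tl', rfl⟩ : ∃ tl', tl = v :: tl' := by
        cases tl with
        | nil => simp at h
        | cons w tl => exact ⟨tl, by simpa using h⟩
      exact if_congr (by simp [Stacked, hv]) rfl rfl
    · refine Finset.sum_eq_zero fun l _ => ?_
      rw [if_neg]
      rintro (⟨hv', -⟩ | ⟨-, _, tl', heq, -⟩)
      · exact hv' hv
      · exact h (by rw [(List.cons.inj heq).2]; rfl)

variable {rel}

/-- A push has at most `β⁻²` targets and a pop has one. Descending from height `h` in `k` steps
takes `(k - h) / 2` pushes, so each height profile is realised at most `β ^ (h - k)` times. -/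
lemma stackedCount_le {β : ℝ} (h0 : 0 < β) (hdeg : ∀ u, β ^ 2 * (nbrs rel u).card ≤ 1) (k : ℕ)
    (u : V) (tl : List V) (O : Finset V) :
    β ^ k * stackedCount rel k u tl O ≤ ballot k tl.length * β ^ tl.length := by
  induction k generalizing u tl O with
  | zero =>
    rw [stackedCount_zero]
    cases tl <;> simp [ballot]
  | succ k ih =>
    rw [stackedCount_succ]
    push_cast
    rw [mul_add]
    have h1 : β ^ (k + 1) * ∑ v ∈ (nbrs rel u).filter (fun v => v ∉ O),
        (stackedCount rel k v (u :: tl) (insert v O) : ℝ)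
        ≤ ballot k (tl.length + 1) * β ^ tl.length := by
      rw [Finset.mul_sum]
      calc _ ≤ ∑ v ∈ (nbrs rel u).filter (fun v => v ∉ O),
            β * (ballot k (tl.length + 1) * β ^ (tl.length + 1)) := by
            refine Finset.sum_le_sum fun v _ => ?_
            rw [pow_succ', mul_assoc]
            exact mul_le_mul_of_nonneg_left (ih v (u :: tl) (insert v O)) h0.le
        _ ≤ (nbrs rel u).card * (β * (ballot k (tl.length + 1) * β ^ (tl.length + 1))) := by
            rw [Finset.sum_const, nsmul_eq_mul]
            gcongr
            exact Finset.filter_subset _ _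
        _ = (β ^ 2 * (nbrs rel u).card) * (ballot k (tl.length + 1) * β ^ tl.length) := by ring
        _ ≤ _ := mul_le_of_le_one_left (by positivity) (hdeg u)
    cases tl with
    | nil => simpa [ballot] using h1
    | cons w tl =>
      have h2 : β ^ (k + 1) * ∑ v ∈ (nbrs rel u).filter (fun v => v ∈ O),
          (if (w :: tl).head? = some v then (stackedCount rel k v (w :: tl).tail O : ℝ) else 0)
          ≤ ballot k tl.length * β ^ (tl.length + 1) := by
        have h3 : ∑ v ∈ (nbrs rel u).filter (fun v => v ∈ O),
            (if (w :: tl).head? = some v then (stackedCount rel k v (w :: tl).tail O : ℝ) else 0)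
            ≤ stackedCount rel k w tl O := by
          simp only [List.head?_cons, Option.some.injEq, List.tail_cons]
          rw [Finset.sum_ite_eq]
          split_ifs <;> simp
        calc _ ≤ β ^ (k + 1) * stackedCount rel k w tl O := by gcongr
          _ = β * (β ^ k * stackedCount rel k w tl O) := by ring
          _ ≤ β * (ballot k tl.length * β ^ tl.length) := mul_le_mul_of_nonneg_left (ih w tl O) h0.le
          _ = _ := by ring
      refine (add_le_add h1 h2).trans (le_of_eq ?_)
      simp only [List.length_cons, ballot]
      push_cast
      ring

/-- At most `K` vertices are ever forbidden, so a push has at least `θ β⁻²` targets. Pops are steps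
of `rel` because the stack stays a chain, by symmetry. The factor `θ ≤ 1` is paid on every step,
although only pushes need it. -/
lemma le_stackedCount {β θ : ℝ} (h0 : 0 < β) (hθ : 0 ≤ θ) (hθ1 : θ ≤ 1)
    (hsymm : ∀ u v, rel u v → rel v u) {K : ℕ}
    (hdeg : ∀ u, θ ≤ β ^ 2 * ((nbrs rel u).card - K)) (k : ℕ)
    {u : V} {tl : List V} {O : Finset V} (hst : (u :: tl).IsChain rel)
    (hO : ∀ x ∈ u :: tl, x ∈ O) (hK : O.card + k ≤ K) :
    ballot k tl.length * β ^ tl.length * θ ^ k ≤ β ^ k * stackedCount rel k u tl O := by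
  induction k generalizing u tl O with
  | zero =>
    rw [stackedCount_zero]
    cases tl <;> simp [ballot]
  | succ k ih =>
    rw [stackedCount_succ]
    push_cast
    rw [mul_add]
    have h1 : ballot k (tl.length + 1) * β ^ tl.length * θ ^ (k + 1)
        ≤ β ^ (k + 1) * ∑ v ∈ (nbrs rel u).filter (fun v => v ∉ O),
          (stackedCount rel k v (u :: tl) (insert v O) : ℝ) := by
      rw [Finset.mul_sum]
      have hcard : ((nbrs rel u).card : ℝ) - K
          ≤ ((nbrs rel u).filter (fun v => v ∉ O)).card := by
        have h3 := Finset.card_filter_add_card_filter_not (s := nbrs rel u) (fun v => v ∈ O)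
        have h4 : ((nbrs rel u).filter (fun v => v ∈ O)).card ≤ O.card :=
          Finset.card_le_card fun v hv => (Finset.mem_filter.1 hv).2
        have h5 : ((nbrs rel u).card : ℝ)
            ≤ K + ((nbrs rel u).filter (fun v => v ∉ O)).card := by
          exact_mod_cast (by omega)
        linarith
      calc _ = θ * (ballot k (tl.length + 1) * β ^ tl.length * θ ^ k) := by ring
        _ ≤ (β ^ 2 * ((nbrs rel u).filter (fun v => v ∉ O)).card) *
            (ballot k (tl.length + 1) * β ^ tl.length * θ ^ k) := by
            gcongr
            exact (hdeg u).trans (by gcongr)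
        _ = ∑ v ∈ (nbrs rel u).filter (fun v => v ∉ O),
            β * (ballot k (tl.length + 1) * β ^ (tl.length + 1) * θ ^ k) := by
            rw [Finset.sum_const, nsmul_eq_mul]
            ring
        _ ≤ _ := by
            refine Finset.sum_le_sum fun v hv => ?_
            rw [Finset.mem_filter] at hv
            rw [pow_succ' β k, mul_assoc β (β ^ k)]
            refine mul_le_mul_of_nonneg_left (ih (tl := u :: tl) ?_ ?_ ?_) h0.le
            · rw [List.isChain_cons_cons]
              exact ⟨hsymm _ _ (by simpa [nbrs] using hv.1), hst⟩
            · intro x hx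
              rcases List.mem_cons.1 hx with rfl | hx
              · exact Finset.mem_insert_self _ _
              · exact Finset.mem_insert_of_mem (hO x hx)
            · rw [Finset.card_insert_of_notMem hv.2]
              omega
    cases tl with
    | nil => simpa [ballot] using h1
    | cons w tl =>
      have hw : rel u w ∧ (w :: tl).IsChain rel := List.isChain_cons_cons.1 hst
      have h2 : ballot k tl.length * β ^ (tl.length + 1) * θ ^ (k + 1)
          ≤ β ^ (k + 1) * ∑ v ∈ (nbrs rel u).filter (fun v => v ∈ O),
          (if (w :: tl).head? = some v then (stackedCount rel k v (w :: tl).tail O : ℝ) else 0) := by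
        have h3 : ∑ v ∈ (nbrs rel u).filter (fun v => v ∈ O),
            (if (w :: tl).head? = some v then (stackedCount rel k v (w :: tl).tail O : ℝ) else 0)
            = stackedCount rel k w tl O := by
          simp only [List.head?_cons, Option.some.injEq, List.tail_cons]
          rw [Finset.sum_ite_eq, if_pos]
          simp [nbrs, hw.1, hO w]
        rw [h3]
        calc _ = (β * θ) * (ballot k tl.length * β ^ tl.length * θ ^ k) := by ring
          _ ≤ (β * 1) * (ballot k tl.length * β ^ tl.length * θ ^ k) := by gcongr
          _ ≤ (β * 1) * (β ^ k * stackedCount rel k w tl O) :=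
            mul_le_mul_of_nonneg_left
              (ih hw.2 (fun x hx => hO x (List.mem_cons_of_mem _ hx)) (by omega)) (by positivity)
          _ = _ := by ring
      refine (le_of_eq ?_).trans (add_le_add h1 h2)
      simp only [List.length_cons, ballot]
      push_cast
      ring

lemma card_treeWalks (k : ℕ) :
    (treeWalks rel k).card = ∑ r, stackedCount rel k r [] {r} := by
  rw [treeWalks, Finset.card_sigma]
  rfl

lemma card_treeWalks_le {β : ℝ} (h0 : 0 < β) (hdeg : ∀ u, β ^ 2 * (nbrs rel u).card ≤ 1)
    (k : ℕ) : β ^ k * (treeWalks rel k).card ≤ Fintype.card V * ballot k 0 := by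
  rw [card_treeWalks]
  push_cast
  rw [Finset.mul_sum]
  refine (Finset.sum_le_sum fun r _ => stackedCount_le h0 hdeg k r [] {r}).trans ?_
  simp

lemma le_card_treeWalks {β θ : ℝ} (h0 : 0 < β) (hθ : 0 ≤ θ) (hθ1 : θ ≤ 1)
    (hsymm : ∀ u v, rel u v → rel v u) (k : ℕ)
    (hdeg : ∀ u, θ ≤ β ^ 2 * ((nbrs rel u).card - (k + 1 : ℕ))) :
    Fintype.card V * ballot k 0 * θ ^ k ≤ β ^ k * (treeWalks rel k).card := by
  rw [card_treeWalks]
  push_cast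
  rw [Finset.mul_sum]
  refine (le_of_eq ?_).trans (Finset.sum_le_sum fun r _ =>
    le_stackedCount (rel := rel) h0 hθ hθ1 hsymm hdeg k (u := r) (tl := []) (O := {r})
      (by simp) (by simp) (by simp; omega))
  simp
  ring

/-- A tree walk traverses no loop. -/
lemma not_isDiag_of_stacked (l : List V) {u : V} {tl : List V} {O : Finset V}
    (hnd : (u :: tl).Nodup) (hO : ∀ x ∈ u :: tl, x ∈ O) (hs : Stacked (u :: tl) O l) :
    ∀ e ∈ edges u l, ¬ e.IsDiag := by
  induction l generalizing u tl O with
  | nil => simp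
  | cons v l ih =>
    intro e he
    rw [edges_cons, Multiset.mem_cons] at he
    rcases hs with ⟨hv, hs⟩ | ⟨hv, u', tl', heq, hs⟩
    · have hv' : v ∉ u :: tl := fun h => hv (hO v h)
      rcases he with rfl | he
      · rw [Sym2.mk_isDiag_iff]
        rintro rfl
        exact hv' (by simp)
      · refine ih (List.nodup_cons.2 ⟨hv', hnd⟩) ?_ hs e he
        intro x hx
        rcases List.mem_cons.1 hx with rfl | hx
        · exact Finset.mem_insert_self _ _
        · exact Finset.mem_insert_of_mem (hO x hx)
    · obtain ⟨rfl, rfl⟩ : u = u' ∧ tl = v :: tl' := by simpa using heq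
      rcases he with rfl | he
      · rw [Sym2.mk_isDiag_iff]
        rintro rfl
        exact (List.nodup_cons.1 hnd).1 (by simp)
      · exact ih (List.nodup_cons.1 hnd).2 (fun x hx => hO x (List.mem_cons_of_mem _ hx)) hs e he

lemma exists_split_of_mem_edges {u v : V} (l : List V) {r : V} (h : s(u, v) ∈ edges r l) :
    ∃ l₁ l₂ u' v', l = l₁ ++ v' :: l₂ ∧ (r :: l₁).getLast (by simp) = u' ∧
      s(u', v') = s(u, v) := by
  induction l generalizing r with
  | nil => simp at h
  | cons w l ih =>
    rw [edges_cons, Multiset.mem_cons] at h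
    rcases h with h | h
    · exact ⟨[], l, r, w, rfl, rfl, h.symm⟩
    · obtain ⟨l₁, l₂, u', v', rfl, h1, h2⟩ := ih h
      exact ⟨w :: l₁, l₂, u', v', rfl, by rw [List.getLast_cons_cons, h1], h2⟩

/-- Rotating a tree walk so that it starts with a given edge leaves a path that visits few
further vertices. -/
lemma tail_rotate_mem_paths {k : ℕ} {r u v : V} (huv : u ≠ v) {l l₁ l₂ : List V}
    (hl : l ∈ paths rel k r) (ht : IsTreeWalk r l) (hsplit : l = l₁ ++ v :: l₂)
    (hu : (r :: l₁).getLast (by simp) = u) :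
    (l.rotate l₁.length).tail ∈ paths rel (k - 1) v ∧
      2 * newCount {u, v} (l.rotate l₁.length).tail + 2 ≤ k := by
  have hrot : (l.rotate l₁.length).tail = l₂ ++ l₁ := by
    rw [hsplit, List.rotate_append_length_eq]
    rfl
  rw [mem_paths] at hl
  obtain ⟨hlen, hchain⟩ := hl
  have hlast := ht.getLast_eq
  have hnew := ht.newCount_le
  have hr : (v :: l₂).getLast (by simp) = r := by
    subst hsplit
    rw [List.getLast_cons (by simp), List.getLast_append_of_ne_nil _ (by simp)] at hlast
    exact hlast
  have hrl : r ∈ l := by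
    rw [hsplit, List.mem_append]
    exact Or.inr (hr ▸ List.getLast_mem _)
  have hul : u ∈ l := by
    rcases List.mem_cons.1 (hu ▸ List.getLast_mem (by simp) : u ∈ r :: l₁) with rfl | h
    · exact hrl
    · rw [hsplit]; exact List.mem_append_left _ h
  have hvl : v ∈ l := by rw [hsplit]; simp
  rw [hrot]
  constructor
  · rw [mem_paths]
    constructor
    · rw [← hlen, hsplit]
      simp only [List.length_append, List.length_cons]
      omega
    · have hc : ((r :: l₁) ++ (v :: l₂)).IsChain rel := by
        rw [hsplit] at hchain; exact hchain
      rw [List.isChain_append] at hc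
      change ((v :: l₂) ++ l₁).IsChain rel
      rw [List.isChain_append]
      -- The two pieces are glued at the root: the closed walk arrives at `r` at the end of `v ::
      -- l₂`, and `r` steps to the head of `l₁`.
      refine ⟨hc.2.1, hc.1.tail, fun x hx y hy => ?_⟩
      rw [List.getLast?_eq_some_getLast (by simp), hr] at hx
      obtain rfl : r = x := by simpa using hx
      cases l₁ with
      | nil => simp at hy
      | cons w l₁ =>
        obtain rfl : w = y := by simpa using hy
        exact (List.isChain_cons_cons.1 hc.1).1
  -- Removing both endpoints of the edge leaves one vertex fewer than removing the root alone; this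
  -- is the saving of 2 over `IsTreeWalk.newCount_le`.
  · have h1 : newCount {r} l = l.toFinset.card - 1 := by
      rw [newCount, Finset.card_sdiff_of_subset (by simpa using hrl), Finset.card_singleton]
    have h2 : newCount {u, v} (l₂ ++ l₁) ≤ l.toFinset.card - 2 := by
      rw [newCount, ← Finset.card_pair huv, ← Finset.card_sdiff_of_subset
        (by simp [Finset.insert_subset_iff, hul, hvl])]
      refine Finset.card_le_card (Finset.sdiff_subset_sdiff (fun x hx => ?_) le_rfl)
      rw [List.mem_toFinset, List.mem_append] at hx
      rw [List.mem_toFinset, hsplit, List.mem_append, List.mem_cons]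
      tauto
    have h3 : 2 ≤ l.toFinset.card := by
      rw [← Finset.card_pair huv]
      exact Finset.card_le_card (by simp [Finset.insert_subset_iff, hul, hvl])
    omega

/-- The missing new vertex leaves a spare factor `β ^ 2` after the weighted sum over all paths. This
spare factor is the price of prescribing an edge. -/
lemma card_few_new_le {β : ℝ} (h0 : 0 < β) (h1 : β ≤ 1)
    (hdeg : ∀ u, β ^ 2 * (nbrs rel u).card ≤ 1) {k : ℕ} (hk : 1 ≤ k) (u v : V) :
    β ^ k * ((paths rel (k - 1) v).filter fun m => 2 * newCount {u, v} m + 2 ≤ k).card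
      ≤ ((k : ℝ) + 3) ^ k * β ^ 2 := by
  rw [mul_comm, ← nsmul_eq_mul, ← Finset.sum_const]
  calc _ ≤ ∑ m ∈ (paths rel (k - 1) v).filter (fun m => 2 * newCount {u, v} m + 2 ≤ k),
        (β ^ 2) ^ newCount {u, v} m * β ^ 2 := by
        refine Finset.sum_le_sum fun m hm => ?_
        refine (pow_le_pow_of_le_one h0.le h1 (Finset.mem_filter.1 hm).2).trans (le_of_eq ?_)
        rw [← pow_mul]
        ring
    _ ≤ ∑ m ∈ paths rel (k - 1) v, (β ^ 2) ^ newCount {u, v} m * β ^ 2 :=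
        Finset.sum_le_sum_of_subset_of_nonneg (Finset.filter_subset _ _)
          fun _ _ _ => by positivity
    _ ≤ _ := by
        rw [← Finset.sum_mul]
        gcongr
        refine (sum_pow_newCount_le (by positivity) hdeg (k - 1) v {u, v}).trans ?_
        have h2 : ((({u, v} : Finset V).card : ℝ)) ≤ 2 := by
          exact_mod_cast Finset.card_le_two
        have h3 : ((k - 1 : ℕ) : ℝ) ≤ k := by exact_mod_cast Nat.sub_le k 1
        calc _ ≤ ((k : ℝ) + 3) ^ (k - 1) := by
              gcongr ?_ ^ _
              linarith
          _ ≤ _ := by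
              gcongr
              · linarith [(Nat.cast_nonneg k : (0:ℝ) ≤ k)]
              · omega

/-- The number of tree walks that traverse a given edge. -/
lemma card_treeWalks_mem_edges_le {β : ℝ} (h0 : 0 < β) (h1 : β ≤ 1)
    (hdeg : ∀ u, β ^ 2 * (nbrs rel u).card ≤ 1) (k : ℕ) {u v : V} (huv : u ≠ v) :
    β ^ k * ((treeWalks rel k).filter fun w => s(u, v) ∈ edges w.1 w.2).card
      ≤ 2 * k * ((k : ℝ) + 3) ^ k * β ^ 2 := by
  classical
  set P : V → V → ℕ → (Σ _ : V, List V) → Prop := fun u' v' t w =>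
    ∃ l₁ l₂, w.2 = l₁ ++ v' :: l₂ ∧ (w.1 :: l₁).getLast (by simp) = u' ∧ l₁.length = t with hP
  have hmem : ∀ w ∈ treeWalks rel k, w.2 ∈ paths rel k w.1 ∧ IsTreeWalk w.1 w.2 := by
    intro w hw
    rw [treeWalks, Finset.mem_sigma, Finset.mem_filter] at hw
    exact hw.2
  have hpiece : ∀ u' v' : V, u' ≠ v' → ∀ t < k,
      β ^ k * ((treeWalks rel k).filter (P u' v' t)).card ≤ ((k : ℝ) + 3) ^ k * β ^ 2 := by
    intro u' v' huv' t ht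
    refine le_trans ?_ (card_few_new_le h0 h1 hdeg (by omega : 1 ≤ k) u' v')
    gcongr
    refine Finset.card_le_card_of_injOn (fun w => (w.2.rotate t).tail) ?_ ?_
    · intro w hw
      obtain ⟨hwt, l₁, l₂, hs, hl, rfl⟩ := Finset.mem_filter.1 hw
      obtain ⟨hp, htr⟩ := hmem w hwt
      exact Finset.mem_coe.2 (Finset.mem_filter.2 (tail_rotate_mem_paths huv' hp htr hs hl))
    -- Injectivity: the entry deleted by `tail` is always `v'`, rotation by `t` can be undone, and
    -- the root is the last vertex of the list.
    · have hrec : ∀ w ∈ (treeWalks rel k).filter (P u' v' t),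
          w.2.rotate t = v' :: (w.2.rotate t).tail ∧ w.2.getLast? = some w.1 := by
        intro w hw
        obtain ⟨hwt, l₁, l₂, hs, hl, rfl⟩ := Finset.mem_filter.1 hw
        obtain ⟨hp, htr⟩ := hmem w hwt
        constructor
        · rw [hs, List.rotate_append_length_eq]
          rfl
        · have := htr.getLast_eq
          have hne : w.2 ≠ [] := by rw [hs]; simp
          rw [List.getLast_cons hne] at this
          rw [List.getLast?_eq_some_getLast hne, this]
      intro w hw w' hw' heq
      have h2 : w.2 = w'.2 := by
        apply List.rotate_injective t
        change w.2.rotate t = w'.2.rotate t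
        rw [(hrec w hw).1, (hrec w' hw').1]
        exact congrArg _ heq
      have h3 := (hrec w hw).2
      rw [h2, (hrec w' hw').2] at h3
      exact Sigma.ext (Option.some.inj h3).symm (heq_of_eq h2)
  have hcover : ((treeWalks rel k).filter fun w => s(u, v) ∈ edges w.1 w.2) ⊆
      (Finset.range k).biUnion fun t =>
        (treeWalks rel k).filter (P u v t) ∪ (treeWalks rel k).filter (P v u t) := by
    intro w hw
    obtain ⟨hwt, he⟩ := Finset.mem_filter.1 hw
    obtain ⟨l₁, l₂, u', v', hs, hl, he⟩ := exists_split_of_mem_edges _ he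
    have hlen := ((mem_paths rel).1 (hmem w hwt).1).1
    rw [Finset.mem_biUnion]
    refine ⟨l₁.length, ?_, ?_⟩
    · rw [Finset.mem_range, ← hlen, hs]
      simp
    · rw [Finset.mem_union, Finset.mem_filter, Finset.mem_filter]
      rcases Sym2.eq_iff.1 he with ⟨rfl, rfl⟩ | ⟨rfl, rfl⟩
      · exact Or.inl ⟨hwt, l₁, l₂, hs, hl, rfl⟩
      · exact Or.inr ⟨hwt, l₁, l₂, hs, hl, rfl⟩
  -- The edge may occur at any of `k` positions and in two directions.
  calc _ ≤ β ^ k * ∑ t ∈ Finset.range k, ((((treeWalks rel k).filter (P u v t)).card : ℝ)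
        + ((treeWalks rel k).filter (P v u t)).card) := by
        gcongr
        have := (Finset.card_le_card hcover).trans (Finset.card_biUnion_le.trans
          (Finset.sum_le_sum fun t _ => Finset.card_union_le _ _))
        exact_mod_cast this
    _ ≤ ∑ t ∈ Finset.range k, (((k : ℝ) + 3) ^ k * β ^ 2 + ((k : ℝ) + 3) ^ k * β ^ 2) := by
        rw [Finset.mul_sum]
        refine Finset.sum_le_sum fun t ht => ?_
        rw [mul_add]
        exact add_le_add (hpiece u v huv t (Finset.mem_range.1 ht))
          (hpiece v u huv.symm t (Finset.mem_range.1 ht))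
    _ = _ := by
        rw [Finset.sum_const, Finset.card_range, nsmul_eq_mul]
        ring

open Classical in
/-- The number of pairs of tree walks that share an edge. -/
lemma card_treeWalks_pairs_le {β : ℝ} (h0 : 0 < β) (h1 : β ≤ 1)
    (hdeg : ∀ u, β ^ 2 * (nbrs rel u).card ≤ 1) (k : ℕ) :
    β ^ (2 * k) * (((treeWalks rel k) ×ˢ (treeWalks rel k)).filter
      fun w : (Σ _ : V, List V) × (Σ _ : V, List V) =>
      ¬ Disjoint (edges w.1.1 w.1.2) (edges w.2.1 w.2.2)).card
      ≤ Fintype.card V * ballot k 0 * (2 * k ^ 2 * ((k : ℝ) + 3) ^ k) * β ^ 2 := by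
  have hmem : ∀ w ∈ treeWalks rel k, w.2.length = k ∧ IsTreeWalk w.1 w.2 := by
    intro w hw
    rw [treeWalks, Finset.mem_sigma, Finset.mem_filter, mem_paths] at hw
    exact ⟨hw.2.1.1, hw.2.2⟩
  have hpiece : ∀ w ∈ treeWalks rel k, β ^ k * ((treeWalks rel k).filter fun w' =>
      ¬ Disjoint (edges w.1 w.2) (edges w'.1 w'.2)).card
      ≤ k * (2 * k * ((k : ℝ) + 3) ^ k * β ^ 2) := by
    intro w hw
    have hcover : ((treeWalks rel k).filter fun w' =>
        ¬ Disjoint (edges w.1 w.2) (edges w'.1 w'.2)) ⊆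
        (edges w.1 w.2).toFinset.biUnion fun e =>
          (treeWalks rel k).filter fun w' => e ∈ edges w'.1 w'.2 := by
      intro w' hw'
      obtain ⟨hw', he⟩ := Finset.mem_filter.1 hw'
      rw [Multiset.disjoint_left] at he
      push Not at he
      obtain ⟨e, he, he'⟩ := he
      exact Finset.mem_biUnion.2 ⟨e, Multiset.mem_toFinset.2 he, Finset.mem_filter.2 ⟨hw', he'⟩⟩
    calc _ ≤ β ^ k * ∑ e ∈ (edges w.1 w.2).toFinset,
          (((treeWalks rel k).filter fun w' => e ∈ edges w'.1 w'.2).card : ℝ) := by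
          gcongr
          exact_mod_cast (Finset.card_le_card hcover).trans Finset.card_biUnion_le
      _ ≤ ∑ e ∈ (edges w.1 w.2).toFinset, 2 * k * ((k : ℝ) + 3) ^ k * β ^ 2 := by
          rw [Finset.mul_sum]
          refine Finset.sum_le_sum fun e he => ?_
          -- Prescribing an edge saves a vertex only if its endpoints differ; tree walks have no
          -- loops.
          have hd := not_isDiag_of_stacked w.2 (tl := []) (by simp) (by simp) (hmem w hw).2 e
            (Multiset.mem_toFinset.1 he)
          induction e using Sym2.ind with
          | _ u v => exact card_treeWalks_mem_edges_le h0 h1 hdeg k (by simpa using hd)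
      _ ≤ _ := by
          rw [Finset.sum_const, nsmul_eq_mul]
          gcongr
          refine (Multiset.toFinset_card_le _).trans ?_
          rw [card_edges, (hmem w hw).1]
  have hcard : (((treeWalks rel k) ×ˢ (treeWalks rel k)).filter
      fun w : (Σ _ : V, List V) × (Σ _ : V, List V) =>
      ¬ Disjoint (edges w.1.1 w.1.2) (edges w.2.1 w.2.2)).card
      = ∑ w ∈ treeWalks rel k, ((treeWalks rel k).filter fun w' =>
        ¬ Disjoint (edges w.1 w.2) (edges w'.1 w'.2)).card := by
    simp only [Finset.card_filter]
    rw [Finset.sum_product]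
  rw [hcard]
  push_cast
  calc _ = β ^ k * ∑ w ∈ treeWalks rel k, β ^ k * (((treeWalks rel k).filter fun w' =>
        ¬ Disjoint (edges w.1 w.2) (edges w'.1 w'.2)).card : ℝ) := by
        rw [← Finset.mul_sum]; ring
    _ ≤ β ^ k * ∑ w ∈ treeWalks rel k, k * (2 * k * ((k : ℝ) + 3) ^ k * β ^ 2) := by
        exact mul_le_mul_of_nonneg_left (Finset.sum_le_sum hpiece) (by positivity)
    _ = (β ^ k * (treeWalks rel k).card) * (k * (2 * k * ((k : ℝ) + 3) ^ k * β ^ 2)) := by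
        rw [Finset.sum_const, nsmul_eq_mul]; ring
    _ ≤ (Fintype.card V * ballot k 0) * (k * (2 * k * ((k : ℝ) + 3) ^ k * β ^ 2)) := by
        exact mul_le_mul_of_nonneg_right (card_treeWalks_le h0 hdeg k) (by positivity)
    _ = _ := by ring

end Count
-- Products of matrix entries along edges.
section EdgeProd

variable {V : Type*}

/-- The entry of a symmetric matrix at an unordered pair. -/
noncomputable def entry (A : Matrix V V ℝ) (e : Sym2 V) : ℝ := A (Quot.out e).1 (Quot.out e).2

lemma mk_out (e : Sym2 V) : s((Quot.out e).1, (Quot.out e).2) = e := Quot.out_eq e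

lemma entry_mk {A : Matrix V V ℝ} (hA : A.IsSymm) (u v : V) : entry A s(u, v) = A u v := by
  rcases Sym2.eq_iff.1 (mk_out s(u, v)) with ⟨h1, h2⟩ | ⟨h1, h2⟩
  · rw [entry, h1, h2]
  · rw [entry, h1, h2, hA.apply]

/-- The product of the matrix entries at the edges in `L`. -/
noncomputable def edgeProd (A : Matrix V V ℝ) (L : Multiset (Sym2 V)) : ℝ := (L.map (entry A)).prod

lemma edgeProd_add (A : Matrix V V ℝ) (L L' : Multiset (Sym2 V)) :
    edgeProd A (L + L') = edgeProd A L * edgeProd A L' := by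
  simp [edgeProd]

lemma edgeProd_cons (A : Matrix V V ℝ) (e : Sym2 V) (L : Multiset (Sym2 V)) :
    edgeProd A (e ::ₘ L) = entry A e * edgeProd A L := by
  simp [edgeProd]

lemma edgeProd_totalEdges (A : Matrix V V ℝ) (ws : List (Σ _ : V, List V)) :
    edgeProd A (totalEdges ws) = (ws.map fun w => edgeProd A (edges w.1 w.2)).prod := by
  induction ws with
  | nil => simp [totalEdges, edgeProd]
  | cons w ws ih =>
    rw [List.map_cons, List.prod_cons, ← ih, ← edgeProd_add]
    rfl

end EdgeProd

/-! ### Moments of the tree part and of the non-tree part. -/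

section Moments

variable {Ω : Type*} [MeasurableSpace Ω] {μ : Measure Ω}
  {a : (n : ℕ) → Ω → Matrix (Fin n) (Fin n) ℝ} {C : ℕ → ℝ} {Cn : ℕ → ℕ → ℝ}

/-- The expectations of products of entries, in terms of multisets of edges. -/
lemma IsApproxUncorrelated.integral_edgeProd (ha : IsApproxUncorrelated μ a C Cn) (n : ℕ)
    {L : Multiset (Sym2 (Fin n))} (hL : L ≠ 0) :
    Integrable (fun ω => edgeProd (a n ω) L) μ ∧
    |∫ ω, edgeProd (a n ω) L ∂μ| ≤ C L.card / (n : ℝ) ^ ((1 / 2 : ℝ) * simpleCount L) ∧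
    ((∀ e ∈ L, L.count e = 2) →
      |∫ ω, edgeProd (a n ω) L ∂μ - 1| ≤ Cn L.toFinset.card n) := by
  set S := L.toFinset with hS
  have hcard : 1 ≤ S.card := Finset.card_pos.2 (by
    rwa [hS, Finset.nonempty_iff_ne_empty, Ne, Multiset.toFinset_eq_empty])
  -- The distinct edges are enumerated, each represented by an arbitrary ordered pair, with its
  -- multiplicity in `L` as exponent.
  set σ : Fin S.card ≃ S := S.equivFin.symm with hσ
  set P : Fin S.card → Fin n × Fin n := fun i => Quot.out (σ i).1 with hP
  set δ : Fin S.card → ℕ := fun i => L.count (σ i).1 with hδ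
  have hfd : FundamentallyDifferent P := by
    intro i j hij h
    apply hij
    rw [hP, mk_out, mk_out] at h
    exact σ.injective (Subtype.ext h)
  have hδ1 : ∀ i, 1 ≤ δ i := fun i =>
    Multiset.one_le_count_iff_mem.2 (Multiset.mem_toFinset.1 (σ i).2)
  have hsum : ∑ i, δ i = L.card := by
    rw [σ.sum_comp (fun e : S => L.count e.1), Finset.sum_coe_sort S (fun e => L.count e)]
    exact Multiset.toFinset_sum_count_eq L
  have hone : (Finset.univ.filter fun i => δ i = 1).card = simpleCount L := by
    rw [simpleCount, Finset.card_filter, Finset.card_filter,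
      σ.sum_comp (fun e : S => if L.count e.1 = 1 then 1 else 0),
      Finset.sum_coe_sort S (fun e => if L.count e = 1 then 1 else 0)]
  have hprod : ∀ ω, edgeProd (a n ω) L = ∏ i, a n ω (P i).1 (P i).2 ^ δ i := by
    intro ω
    rw [edgeProd, Finset.prod_multiset_map_count,
      ← Finset.prod_coe_sort, ← σ.prod_comp]
    rfl
  simp only [hprod]
  refine ⟨ha.integrable n _ hcard P hfd δ hδ1, ?_, fun h2 => ?_⟩
  · have := ha.au1 n _ hcard P hfd δ hδ1
    rwa [hsum, hone] at this
  · have hδ2 : ∀ i, δ i = 2 := fun i => h2 _ (Multiset.mem_toFinset.1 (σ i).2)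
    simp only [hδ2]
    exact ha.au2 n _ hcard P hfd

/-- The hypothesis `hn` says `n ^ (-1/2) ≤ β`, so the gain in (AU1) becomes a power of `β`. Together
with the scaling `β ^ L.card` this gives `β ^ excess L`. -/
lemma IsApproxUncorrelated.abs_integral_le (ha : IsApproxUncorrelated μ a C Cn) {n : ℕ}
    {L : Multiset (Sym2 (Fin n))} (hL : L ≠ 0) {β : ℝ} (hβ : 0 < β)
    (hn : 1 ≤ n * β ^ 2) :
    |∫ ω, edgeProd (a n ω) L ∂μ| ≤ |C L.card| * β ^ simpleCount L := by
  have hn0 : (0 : ℝ) < n := by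
    by_contra h
    have : (n : ℝ) ≤ 0 := not_lt.1 h
    nlinarith [sq_nonneg β]
  refine ((ha.integral_edgeProd n hL).2.1).trans ?_
  have h1 : (1 : ℝ) ≤ √n * β := by
    rw [← Real.sqrt_sq hβ.le, ← Real.sqrt_mul hn0.le]
    exact Real.one_le_sqrt.2 hn
  have h2 : (n : ℝ) ^ ((1 / 2 : ℝ) * simpleCount L) = √n ^ simpleCount L := by
    rw [Real.rpow_mul hn0.le, ← Real.sqrt_eq_rpow, Real.rpow_natCast]
  rw [h2, div_le_iff₀ (by positivity), mul_assoc, ← mul_pow, mul_comm β]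
  exact (le_abs_self _).trans (le_mul_of_one_le_right (abs_nonneg _) (one_le_pow₀ h1))

variable {n : ℕ} (rel : Fin n → Fin n → Prop)

/-- The contribution of the tree walks to the `k`-th moment. -/
noncomputable def treePart (β : ℝ) (k : ℕ) (A : Matrix (Fin n) (Fin n) ℝ) : ℝ :=
  (n : ℝ)⁻¹ * β ^ k * ∑ w ∈ treeWalks rel k, edgeProd A (edges w.1 w.2)

/-- The contribution of the other walks to the `k`-th moment. -/
noncomputable def nonTreePart (β : ℝ) (k : ℕ) (A : Matrix (Fin n) (Fin n) ℝ) : ℝ :=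
  (n : ℝ)⁻¹ * β ^ k * ∑ w ∈ nonTreeWalks rel k, edgeProd A (edges w.1 w.2)

variable {rel}

lemma length_of_mem_nonTreeWalks {k : ℕ} {w : Σ _ : Fin n, List (Fin n)}
    (hw : w ∈ nonTreeWalks rel k) : w.2.length = k := by
  classical
  rw [nonTreeWalks, Finset.mem_sigma, Finset.mem_filter, mem_paths] at hw
  exact hw.2.1.1

lemma length_of_mem_treeWalks {k : ℕ} {w : Σ _ : Fin n, List (Fin n)}
    (hw : w ∈ treeWalks rel k) : w.2.length = k := by
  classical
  rw [treeWalks, Finset.mem_sigma, Finset.mem_filter, mem_paths] at hw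
  exact hw.2.1.1

lemma isTreeWalk_of_mem_treeWalks {k : ℕ} {w : Σ _ : Fin n, List (Fin n)}
    (hw : w ∈ treeWalks rel k) : IsTreeWalk w.1 w.2 := by
  classical
  rw [treeWalks, Finset.mem_sigma, Finset.mem_filter] at hw
  exact hw.2.2

lemma card_totalEdges {k M : ℕ} {ws : List (Σ _ : Fin n, List (Fin n))}
    (h : ws ∈ listsOf (nonTreeWalks rel k) M) : (totalEdges ws).card = k * M := by
  rw [mem_listsOf] at h
  obtain ⟨rfl, h⟩ := h
  induction ws with
  | nil => simp [totalEdges]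
  | cons w ws ih =>
    have h1 := ih fun x hx => h x (List.mem_cons_of_mem _ hx)
    have h2 : totalEdges (w :: ws) = edges w.1 w.2 + totalEdges ws := rfl
    rw [h2, Multiset.card_add, h1, card_edges, length_of_mem_nonTreeWalks (h w (by simp))]
    simp
    ring

lemma nonTreePart_pow (β : ℝ) (k M : ℕ) (A : Matrix (Fin n) (Fin n) ℝ) :
    nonTreePart rel β k A ^ M = ((n : ℝ)⁻¹) ^ M * β ^ (k * M) *
      ∑ ws ∈ listsOf (nonTreeWalks rel k) M, edgeProd A (totalEdges ws) := by
  rw [nonTreePart, mul_pow, mul_pow, sum_pow_eq_sum_listsOf, ← pow_mul]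
  simp only [edgeProd_totalEdges]

/-- The power expands into `M`-tuples of walks, whose weights sum to a constant times `(n β) ^ M`;
the normalisation cancels `n ^ M`. -/
lemma IsApproxUncorrelated.integral_nonTreePart_pow (ha : IsApproxUncorrelated μ a C Cn) {β : ℝ}
    (h0 : 0 < β) (h1 : β ≤ 1) (hdeg : ∀ u, β ^ 2 * (nbrs rel u).card ≤ 1)
    (hn : 1 ≤ n * β ^ 2) {k M : ℕ} (hk : 1 ≤ k) (hM : 1 ≤ M) :
    Integrable (fun ω => nonTreePart rel β k (a n ω) ^ M) μ ∧
    ∫ ω, nonTreePart rel β k (a n ω) ^ M ∂μ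
      ≤ |C (k * M)| * (((M * (k + 1) : ℕ) : ℝ) + 1) ^ ((k + 1) * M) * β ^ M := by
  have hn0 : (n : ℝ) ≠ 0 := by
    rintro h
    rw [h] at hn
    linarith
  have hne : ∀ ws ∈ listsOf (nonTreeWalks rel k) M, totalEdges ws ≠ 0 := by
    intro ws hws h
    have := card_totalEdges hws
    rw [h, Multiset.card_zero] at this
    have : 0 < k * M := Nat.mul_pos hk hM
    omega
  have hint : ∀ ws ∈ listsOf (nonTreeWalks rel k) M,
      Integrable (fun ω => edgeProd (a n ω) (totalEdges ws)) μ :=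
    fun ws hws => (ha.integral_edgeProd n (hne ws hws)).1
  simp only [nonTreePart_pow]
  refine ⟨(integrable_finsetSum _ hint).const_mul _, ?_⟩
  rw [integral_const_mul, integral_finsetSum _ hint]
  calc _ ≤ ((n : ℝ)⁻¹) ^ M * β ^ (k * M) * ∑ ws ∈ listsOf (nonTreeWalks rel k) M,
        |C (k * M)| * β ^ simpleCount (totalEdges ws) := by
        gcongr with ws hws
        refine (le_abs_self _).trans ?_
        rw [← card_totalEdges hws]
        exact ha.abs_integral_le (hne ws hws) h0 hn
    _ = ((n : ℝ)⁻¹) ^ M * |C (k * M)| * ∑ ws ∈ listsOf (nonTreeWalks rel k) M,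
        β ^ excess (totalEdges ws + 0) := by
        rw [Finset.mul_sum, Finset.mul_sum]
        refine Finset.sum_congr rfl fun ws hws => ?_
        rw [add_zero, excess, card_totalEdges hws, pow_add]
        ring
    _ ≤ ((n : ℝ)⁻¹) ^ M * |C (k * M)| *
        ((Fintype.card (Fin n) * β * (((M * (k + 1) : ℕ) : ℝ) + 1) ^ (k + 1)) ^ M
          * β ^ excess (0 : Multiset (Sym2 (Fin n)))) := by
        gcongr
        exact sum_lists_nonTreeWalks_le h0 h1 hdeg (by simpa using hn) k (O := ∅)
          (by simp [Supported]) (by simp)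
    _ = _ := by
        rw [excess_zero, Fintype.card_fin, mul_pow, mul_pow, pow_mul _ (k + 1) M, inv_pow]
        field_simp

/-- Writing X and X' for the two products, E (X - 1)(X' - 1) = (E XX' - 1) - (E X - 1) - (E X' - 1).
For disjoint walks all edges of the union are double, so (AU2) applies to each term, with `k`, `k /
2` and `k / 2` distinct edges. Otherwise (AU1) gives mere boundedness. -/
lemma IsApproxUncorrelated.integral_tree_pair [IsProbabilityMeasure μ]
    (ha : IsApproxUncorrelated μ a C Cn) {β : ℝ} (h0 : 0 < β) (h1 : β ≤ 1)
    (hn : 1 ≤ n * β ^ 2) {k : ℕ} (hk : 1 ≤ k) {w w' : Σ _ : Fin n, List (Fin n)}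
    (hw : w ∈ treeWalks rel k) (hw' : w' ∈ treeWalks rel k) :
    Integrable (fun ω => (edgeProd (a n ω) (edges w.1 w.2) - 1) *
      (edgeProd (a n ω) (edges w'.1 w'.2) - 1)) μ ∧
    (∫ ω, (edgeProd (a n ω) (edges w.1 w.2) - 1) *
      (edgeProd (a n ω) (edges w'.1 w'.2) - 1) ∂μ
        ≤ |C (2 * k)| + 2 * |C k| + 1) ∧
    (Disjoint (edges w.1 w.2) (edges w'.1 w'.2) →
      ∫ ω, (edgeProd (a n ω) (edges w.1 w.2) - 1) *
      (edgeProd (a n ω) (edges w'.1 w'.2) - 1) ∂μ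
        ≤ |Cn k n| + 2 * |Cn (k / 2) n|) := by
  set L := edges w.1 w.2 with hL
  set L' := edges w'.1 w'.2 with hL'
  have hc : L.card = k := by rw [hL, card_edges, length_of_mem_treeWalks hw]
  have hc' : L'.card = k := by rw [hL', card_edges, length_of_mem_treeWalks hw']
  have hLL : (L + L').card = 2 * k := by rw [Multiset.card_add]; omega
  have hne : L ≠ 0 := by rintro h; rw [h] at hc; simp at hc; omega
  have hne' : L' ≠ 0 := by rintro h; rw [h] at hc'; simp at hc'; omega
  have hneL : L + L' ≠ 0 := by rintro h; rw [h] at hLL; simp at hLL; omega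
  have h2 : ∀ e ∈ L, L.count e = 2 := fun e he => (isTreeWalk_of_mem_treeWalks hw).count_edges he
  have h2' : ∀ e ∈ L', L'.count e = 2 :=
    fun e he => (isTreeWalk_of_mem_treeWalks hw').count_edges he
  obtain ⟨i1, -, i2⟩ := ha.integral_edgeProd n hne
  obtain ⟨j1, -, j2⟩ := ha.integral_edgeProd n hne'
  obtain ⟨k1, -, k2⟩ := ha.integral_edgeProd n hneL
  have hexp : ∀ ω, (edgeProd (a n ω) L - 1) * (edgeProd (a n ω) L' - 1)
      = edgeProd (a n ω) (L + L') - edgeProd (a n ω) L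
        - edgeProd (a n ω) L' + 1 := by
    intro ω
    rw [edgeProd_add]
    ring
  have hval : ∫ ω, (edgeProd (a n ω) L - 1) * (edgeProd (a n ω) L' - 1) ∂μ
      = ∫ ω, edgeProd (a n ω) (L + L') ∂μ - ∫ ω, edgeProd (a n ω) L ∂μ
        - ∫ ω, edgeProd (a n ω) L' ∂μ + 1 := by
    simp only [hexp]
    have e1 := integral_add ((k1.sub i1).sub j1) (integrable_const (1 : ℝ))
    have e2 := integral_sub (k1.sub i1) j1
    have e3 := integral_sub k1 i1
    simp only [Pi.sub_apply, integral_const, probReal_univ, smul_eq_mul, mul_one] at e1 e2 e3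
    rw [e1, e2, e3]
  refine ⟨?_, ?_, fun hd => ?_⟩
  · simp only [hexp]
    exact ((k1.sub i1).sub j1).add (integrable_const _)
  · rw [hval]
    have hb : ∀ {L : Multiset (Sym2 (Fin n))}, L ≠ 0 →
        |∫ ω, edgeProd (a n ω) L ∂μ| ≤ |C L.card| := fun h =>
      (ha.abs_integral_le h h0 hn).trans
        (mul_le_of_le_one_right (abs_nonneg _) (pow_le_one₀ h0.le h1))
    have b1 := abs_le.1 (hb hne)
    have b2 := abs_le.1 (hb hne')
    have b3 := abs_le.1 (hb hneL)
    rw [hc] at b1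
    rw [hc'] at b2
    rw [hLL] at b3
    linarith [b1.1, b2.1, b3.2]
  · rw [hval]
    have e1 := two_mul_card_toFinset h2
    have e2 := two_mul_card_toFinset h2'
    have h3 : ∀ e ∈ L + L', (L + L').count e = 2 := by
      intro e he
      rw [Multiset.count_add]
      by_cases hm : e ∈ L
      · rw [h2 e hm, Multiset.count_eq_zero.2 (Multiset.disjoint_left.1 hd hm)]
      · rw [h2' e ((Multiset.mem_add.1 he).resolve_left hm), Multiset.count_eq_zero.2 hm]
    have e3 := two_mul_card_toFinset h3
    have b1 := abs_le.1 (i2 h2)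
    have b2 := abs_le.1 (j2 h2')
    have b3 := abs_le.1 (k2 h3)
    rw [show L.toFinset.card = k / 2 by omega] at b1
    rw [show L'.toFinset.card = k / 2 by omega] at b2
    rw [show (L + L').toFinset.card = k by omega] at b3
    linarith [b1.1, b2.1, b3.2, le_abs_self (Cn k n), le_abs_self (Cn (k / 2) n)]

/-- The deterministic value around which the contribution of the tree walks concentrates. -/
noncomputable def treeMean (rel : Fin n → Fin n → Prop) (β : ℝ) (k : ℕ) : ℝ :=
  (n : ℝ)⁻¹ * β ^ k * (treeWalks rel k).card

/-- All pairs are charged the disjoint bound and those sharing an edge a constant on top. After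
scaling there are O(n²) pairs, but only O(n β²) of them share an edge. -/
lemma IsApproxUncorrelated.integral_treePart_sub_sq [IsProbabilityMeasure μ]
    (ha : IsApproxUncorrelated μ a C Cn) {β : ℝ} (h0 : 0 < β) (h1 : β ≤ 1)
    (hdeg : ∀ u, β ^ 2 * (nbrs rel u).card ≤ 1) (hn : 1 ≤ n * β ^ 2) {k : ℕ} (hk : 1 ≤ k) :
    Integrable (fun ω => (treePart rel β k (a n ω) - treeMean rel β k) ^ 2) μ ∧
    ∫ ω, (treePart rel β k (a n ω) - treeMean rel β k) ^ 2 ∂μ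
      ≤ (ballot k 0 : ℝ) ^ 2 * (|Cn k n| + 2 * |Cn (k / 2) n|)
        + ballot k 0 * (2 * k ^ 2 * ((k : ℝ) + 3) ^ k) * (|C (2 * k)| + 2 * |C k| + 1)
          * (β ^ 2 * (n : ℝ)⁻¹) := by
  classical
  have hn0 : (0 : ℝ) < n := by
    by_contra h
    have : (n : ℝ) ≤ 0 := not_lt.1 h
    nlinarith [sq_nonneg β]
  set f : Ω → (Σ _ : Fin n, List (Fin n)) → ℝ := fun ω w =>
    edgeProd (a n ω) (edges w.1 w.2) - 1 with hf
  set S := treeWalks rel k with hS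
  have hexp : ∀ ω, (treePart rel β k (a n ω) - treeMean rel β k) ^ 2
      = ((n : ℝ)⁻¹) ^ 2 * β ^ (2 * k) * ∑ p ∈ S ×ˢ S, f ω p.1 * f ω p.2 := by
    intro ω
    have : treePart rel β k (a n ω) - treeMean rel β k = (n : ℝ)⁻¹ * β ^ k * ∑ w ∈ S, f ω w := by
      rw [treePart, treeMean, ← mul_sub, hf, Finset.sum_sub_distrib, Finset.sum_const, nsmul_eq_mul,
        mul_one]
    rw [this, Finset.sum_product, ← Finset.sum_mul_sum]
    ring
  have hint : ∀ p ∈ S ×ˢ S, Integrable (fun ω => f ω p.1 * f ω p.2) μ := fun p hp =>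
    (ha.integral_tree_pair h0 h1 hn hk (Finset.mem_product.1 hp).1 (Finset.mem_product.1 hp).2).1
  simp only [hexp]
  refine ⟨(integrable_finsetSum _ hint).const_mul _, ?_⟩
  rw [integral_const_mul, integral_finsetSum _ hint]
  set D := |Cn k n| + 2 * |Cn (k / 2) n| with hD
  set B := |C (2 * k)| + 2 * |C k| + 1 with hB
  have hD0 : 0 ≤ D := by positivity
  have hB0 : 0 ≤ B := by positivity
  set Q : (Σ _ : Fin n, List (Fin n)) × (Σ _ : Fin n, List (Fin n)) → Prop := fun w =>
    ¬ Disjoint (edges w.1.1 w.1.2) (edges w.2.1 w.2.2) with hQ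
  have hsum : ∑ p ∈ S ×ˢ S, ∫ ω, f ω p.1 * f ω p.2 ∂μ
      ≤ (S.card : ℝ) ^ 2 * D + ((S ×ˢ S).filter Q).card * B := by
    calc _ ≤ ∑ p ∈ S ×ˢ S, (D + if Q p then B else 0) := by
          refine Finset.sum_le_sum fun p hp => ?_
          obtain ⟨-, g1, g2⟩ := ha.integral_tree_pair h0 h1 hn hk (Finset.mem_product.1 hp).1
            (Finset.mem_product.1 hp).2
          split_ifs with h
          · exact g1.trans (by linarith)
          · exact (g2 (not_not.1 h)).trans (by linarith)
      _ = _ := by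
          rw [Finset.sum_add_distrib, ← Finset.sum_filter, Finset.sum_const, Finset.sum_const,
            Finset.card_product]
          push_cast [nsmul_eq_mul]
          ring
  have hc1 := card_treeWalks_le h0 hdeg k
  have hc2 := card_treeWalks_pairs_le h0 h1 hdeg k
  rw [Fintype.card_fin] at hc1 hc2
  calc _ ≤ ((n : ℝ)⁻¹) ^ 2 * β ^ (2 * k) *
        ((S.card : ℝ) ^ 2 * D + ((S ×ˢ S).filter Q).card * B) := by gcongr
    _ = ((n : ℝ)⁻¹ * (β ^ k * S.card)) ^ 2 * D
        + ((n : ℝ)⁻¹) ^ 2 * (β ^ (2 * k) * ((S ×ˢ S).filter Q).card) * B := by ring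
    _ ≤ ((n : ℝ)⁻¹ * (n * ballot k 0)) ^ 2 * D
        + ((n : ℝ)⁻¹) ^ 2 * (n * ballot k 0 * (2 * k ^ 2 * ((k : ℝ) + 3) ^ k) * β ^ 2) * B := by
        refine add_le_add ?_ ?_
        · gcongr
        · gcongr
    _ = _ := by
        field_simp

end Moments
-- Moments of the semicircle distribution.
section Semicircle

open Real in
lemma integral_cos_nat_mul {m : ℕ} (hm : m ≠ 0) : ∫ t in (0 : ℝ)..π, cos (m * t) = 0 := by
  have hm' : (m : ℝ) ≠ 0 := by exact_mod_cast hm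
  rw [intervalIntegral.integral_comp_mul_left (fun x => cos x) hm', integral_cos]
  simp [sin_nat_mul_pi]

-- With x = 2 cos t, the ratio sin((h+1)t) / sin t is the Chebyshev polynomial U_h(x/2). The
-- relation x U_h = U_(h+1) + U_(h-1) is the recursion of `ballot`, with sin 0 = 0 as the barrier
-- below height 0, and `r = 0` is orthogonality.
open Real in
lemma integral_two_cos_pow_mul_sin (r h : ℕ) :
    ∫ t in (0 : ℝ)..π, (2 * cos t) ^ r * (sin ((h + 1 : ℕ) * t) * sin t) = π / 2 * ballot r h := by
  have hI : ∀ r h : ℕ, IntervalIntegrable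
      (fun t : ℝ => (2 * cos t) ^ r * (sin (h * t) * sin t)) volume 0 π := fun r h =>
    (Continuous.intervalIntegrable (by fun_prop) _ _)
  induction r generalizing h with
  | zero =>
    have h1 : ∀ t : ℝ, (2 * cos t) ^ 0 * (sin ((h + 1 : ℕ) * t) * sin t)
        = (cos ((h : ℕ) * t) - cos ((h + 2 : ℕ) * t)) / 2 := by
      intro t
      have e1 : ((h : ℕ) : ℝ) * t = (h + 1 : ℕ) * t - t := by push_cast; ring
      have e2 : ((h + 2 : ℕ) : ℝ) * t = (h + 1 : ℕ) * t + t := by push_cast; ring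
      rw [e1, e2, cos_sub, cos_add]
      ring
    simp only [h1]
    rw [intervalIntegral.integral_div, intervalIntegral.integral_sub
      (Continuous.intervalIntegrable (by fun_prop) _ _)
      (Continuous.intervalIntegrable (by fun_prop) _ _),
      integral_cos_nat_mul (m := h + 2) (by omega)]
    cases h with
    | zero => simp [ballot]
    | succ h => rw [integral_cos_nat_mul (by omega)]; simp [ballot]
  | succ r ih =>
    have h1 : ∀ t : ℝ, (2 * cos t) ^ (r + 1) * (sin ((h + 1 : ℕ) * t) * sin t)
        = (2 * cos t) ^ r * (sin ((h + 2 : ℕ) * t) * sin t)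
          + (2 * cos t) ^ r * (sin ((h : ℕ) * t) * sin t) := by
      intro t
      have e1 : ((h : ℕ) : ℝ) * t = (h + 1 : ℕ) * t - t := by push_cast; ring
      have e2 : ((h + 2 : ℕ) : ℝ) * t = (h + 1 : ℕ) * t + t := by push_cast; ring
      rw [e1, e2, sin_sub, sin_add]
      ring
    simp only [h1]
    rw [intervalIntegral.integral_add (hI r (h + 2)) (hI r h), ih (h + 1)]
    cases h with
    | zero => simp [ballot]
    | succ h =>
      rw [ih h, ballot]
      push_cast
      ring

lemma integral_semicircleMeasure (g : ℝ → ℝ) : ∫ x, g x ∂semicircleMeasure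
    = ∫ x in (-2 : ℝ)..2, 1 / (2 * Real.pi) * √(4 - x ^ 2) * g x := by
  have hc : Continuous fun x : ℝ => 1 / (2 * Real.pi) * √(4 - x ^ 2) := by fun_prop
  rw [semicircleMeasure, integral_withDensity_eq_integral_toReal_smul
    (by fun_prop) (by simp), intervalIntegral.integral_of_le (by norm_num),
    setIntegral_eq_integral_of_forall_compl_eq_zero]
  · refine integral_congr_ae (Eventually.of_forall fun x => ?_)
    dsimp only
    rw [ENNReal.toReal_ofReal (by positivity), smul_eq_mul]
  · intro x hx
    have : 4 - x ^ 2 ≤ 0 := by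
      simp only [Set.mem_Ioc, not_and_or, not_lt, not_le] at hx
      rcases hx with hx | hx <;> nlinarith
    simp [Real.sqrt_eq_zero_of_nonpos this]

open Real in
/-- The moments of the semicircle distribution. -/
lemma integral_pow_semicircleMeasure (r : ℕ) :
    ∫ x, x ^ r ∂semicircleMeasure = ballot r 0 := by
  -- The substitution x = 2 cos t runs from 2 down to -2, hence the reversed interval below.
  have hsub := intervalIntegral.integral_comp_mul_deriv (a := 0) (b := π)
    (f := fun t : ℝ => 2 * cos t) (f' := fun t : ℝ => 2 * -sin t)
    (g := fun x : ℝ => 1 / (2 * π) * √(4 - x ^ 2) * x ^ r)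
    (fun t _ => (hasDerivAt_cos t).const_mul 2) (by fun_prop) (by fun_prop)
  simp only [cos_zero, cos_pi, mul_one, mul_neg] at hsub
  rw [integral_semicircleMeasure, intervalIntegral.integral_symm, ← hsub,
    ← intervalIntegral.integral_neg]
  have h1 : ∫ t in (0 : ℝ)..π,
      - -(((fun x : ℝ => 1 / (2 * π) * √(4 - x ^ 2) * x ^ r) ∘ fun t : ℝ => 2 * cos t) t
        * (2 * sin t))
      = ∫ t in (0 : ℝ)..π, 2 / π * ((2 * cos t) ^ r * (sin ((0 + 1 : ℕ) * t) * sin t)) := by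
    refine intervalIntegral.integral_congr fun t ht => ?_
    rw [Set.uIcc_of_le pi_pos.le] at ht
    have hs := sin_nonneg_of_mem_Icc ht
    have h2 : √(4 - (2 * cos t) ^ 2) = 2 * sin t := by
      rw [show 4 - (2 * cos t) ^ 2 = (2 * sin t) ^ 2 by
        have := sin_sq_add_cos_sq t
        nlinarith, Real.sqrt_sq (by positivity)]
    simp only [Function.comp_apply, h2, zero_add, Nat.cast_one, one_mul]
    field_simp
  rw [h1, intervalIntegral.integral_const_mul, integral_two_cos_pow_mul_sin]
  field_simp

lemma integrable_pow_semicircleMeasure (r : ℕ) :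
    Integrable (fun x : ℝ => x ^ r) semicircleMeasure := by
  have hae : ∀ᵐ x ∂semicircleMeasure, |x| ≤ 2 := by
    have hm : MeasurableSet {x : ℝ | ¬ |x| ≤ 2} :=
      (measurableSet_le (f := fun x : ℝ => |x|) (g := fun _ => 2) (by fun_prop) (by fun_prop)).compl
    rw [ae_iff, semicircleMeasure, withDensity_apply _ hm, setLIntegral_eq_zero_iff hm (by fun_prop)]
    refine Eventually.of_forall fun x hx => ?_
    have : 4 - x ^ 2 ≤ 0 := by
      have : 2 < |x| := not_le.1 hx
      nlinarith [sq_abs x]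
    simp [Real.sqrt_eq_zero_of_nonpos this]
  refine Integrable.of_bound (C := 2 ^ r) (by fun_prop) ?_
  filter_upwards [hae] with x hx
  rw [norm_pow, Real.norm_eq_abs]
  gcongr

end Semicircle

/-! ### From moments to bounded continuous functions. -/

section MomentMethod

open Polynomial in
lemma abs_eval_le {p : ℝ[X]} {x : ℝ} (hx : 1 ≤ |x|) :
    |p.eval x| ≤ (∑ i ∈ Finset.range (p.natDegree + 1), |p.coeff i|) * |x| ^ (2 * p.natDegree) := by
  rw [eval_eq_sum_range, Finset.sum_mul]
  refine (Finset.abs_sum_le_sum_abs _ _).trans (Finset.sum_le_sum fun i hi => ?_)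
  rw [abs_mul, abs_pow]
  gcongr ?_ * ?_
  refine pow_le_pow_right₀ hx ?_
  have := Finset.mem_range.1 hi
  omega

/-- Closeness of finitely many moments to those of a measure with even moments at most `4 ^ N` forces
closeness of the integrals of a given bounded continuous function. -/
lemma exists_moments_close (σ : Measure ℝ) [IsProbabilityMeasure σ]
    (hσ : ∀ k, Integrable (fun x : ℝ => x ^ k) σ) (hσ2 : ∀ k, ∫ x, x ^ (2 * k) ∂σ ≤ 4 ^ k)
    (f : ℝ →ᵇ ℝ) {ε : ℝ} (hε : 0 < ε) :
    ∃ (K : ℕ) (δ : ℝ), 0 < δ ∧ ∀ ν : Measure ℝ, IsProbabilityMeasure ν →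
      (∀ k, Integrable (fun x : ℝ => x ^ k) ν) →
      (∀ k < K, |∫ x, x ^ k ∂ν - ∫ x, x ^ k ∂σ| < δ) →
      |∫ x, f x ∂ν - ∫ x, f x ∂σ| < ε := by
  -- Beyond radius 3, `x ^ (2 * L) / 9 ^ L ≥ 1`, whereas even moments grow like `4 ^ k`: tails cost
  -- a multiple of `(4 / 9) ^ L`, and `L` is chosen once the degree of `p` is known.
  obtain ⟨p, hp⟩ := exists_polynomial_near_of_continuousOn (-3) 3 f f.continuous.continuousOn
    (ε / 6) (by positivity)
  set d := p.natDegree with hd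
  set S := ∑ i ∈ Finset.range (d + 1), |p.coeff i| with hS
  set A := S + ‖f‖ with hA
  have hS0 : 0 ≤ S := Finset.sum_nonneg fun _ _ => abs_nonneg _
  have hA0 : 0 ≤ A := by positivity
  obtain ⟨L, hL⟩ : ∃ L : ℕ, 2 * A * 4 ^ d * (4 / 9 : ℝ) ^ L < ε / 6 := by
    have : Tendsto (fun L : ℕ => 2 * A * 4 ^ d * (4 / 9 : ℝ) ^ L) atTop (𝓝 (2 * A * 4 ^ d * 0)) :=
      (tendsto_pow_atTop_nhds_zero_of_lt_one (by norm_num) (by norm_num)).const_mul _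
    rw [mul_zero] at this
    exact (this.eventually (gt_mem_nhds (by positivity))).exists
  have hpt : ∀ x, |f x - p.eval x| ≤ ε / 6 + A / 9 ^ L * x ^ (2 * (d + L)) := by
    intro x
    have hnn : 0 ≤ x ^ (2 * (d + L)) := by rw [pow_mul]; positivity
    by_cases hx : |x| ≤ 3
    · have := hp x (abs_le.1 hx)
      rw [abs_sub_comm]
      have h2 : 0 ≤ A / 9 ^ L * x ^ (2 * (d + L)) := by positivity
      linarith
    · have hx : 3 < |x| := not_le.1 hx
      have h1 : |f x| ≤ ‖f‖ * |x| ^ (2 * d) :=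
        (f.norm_coe_le_norm x).trans (le_mul_of_one_le_right (norm_nonneg _)
          (one_le_pow₀ (by linarith)))
      have h2 : |p.eval x| ≤ S * |x| ^ (2 * d) := abs_eval_le (by linarith)
      have h3 : |f x - p.eval x| ≤ A * |x| ^ (2 * d) := by
        refine (abs_sub _ _).trans ?_
        rw [hA, add_mul]
        linarith
      have h4 : (9 : ℝ) ^ L ≤ |x| ^ (2 * L) := by
        rw [pow_mul]
        gcongr
        nlinarith
      have h5 : A / 9 ^ L * x ^ (2 * (d + L)) = A * |x| ^ (2 * d) * (|x| ^ (2 * L) / 9 ^ L) := by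
        have : x ^ (2 * (d + L)) = |x| ^ (2 * d) * |x| ^ (2 * L) := by
          rw [← pow_add, ← mul_add, pow_mul, pow_mul, sq_abs]
        rw [this]
        ring
      rw [h5]
      have h6 : A * |x| ^ (2 * d) ≤ A * |x| ^ (2 * d) * (|x| ^ (2 * L) / 9 ^ L) :=
        le_mul_of_one_le_right (by positivity) ((one_le_div (by positivity)).2 h4)
      linarith
  have hpi : ∀ ν : Measure ℝ, (∀ k, Integrable (fun x : ℝ => x ^ k) ν) →
      Integrable (fun x => p.eval x) ν ∧
      ∫ x, p.eval x ∂ν = ∑ i ∈ Finset.range (d + 1), p.coeff i * ∫ x, x ^ i ∂ν := by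
    intro ν hν
    simp only [Polynomial.eval_eq_sum_range]
    refine ⟨integrable_finsetSum _ fun i _ => (hν i).const_mul _, ?_⟩
    rw [integral_finsetSum _ fun i _ => (hν i).const_mul _]
    simp only [integral_const_mul]
    rfl
  have happ : ∀ ν : Measure ℝ, IsProbabilityMeasure ν →
      (∀ k, Integrable (fun x : ℝ => x ^ k) ν) →
      |∫ x, f x ∂ν - ∫ x, p.eval x ∂ν| ≤ ε / 6 + A / 9 ^ L * ∫ x, x ^ (2 * (d + L)) ∂ν := by
    intro ν hν1 hν
    rw [← integral_sub (f.integrable ν) (hpi ν hν).1]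
    refine (abs_integral_le_integral_abs).trans ?_
    refine (integral_mono_of_nonneg (Eventually.of_forall fun _ => abs_nonneg _)
      ((integrable_const (ε / 6)).add ((hν _).const_mul _)) (Eventually.of_forall hpt)).trans ?_
    refine le_of_eq ?_
    simp only [Pi.add_apply]
    rw [integral_add (integrable_const _) ((hν _).const_mul _), integral_const_mul]
    simp
  -- The bound 1 on `δ` controls the tail moment of order `2 * (d + L)`; the other bound controls
  -- the integral of `p`. The errors are five terms of at most `ε / 6`.
  refine ⟨2 * (d + L) + d + 1, min 1 (ε / (6 * (S + 1))), lt_min one_pos (by positivity),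
    fun ν hν1 hν hclose => ?_⟩
  have hbd : ∀ m : ℝ, m ≤ 4 ^ (d + L) + 1 → A / 9 ^ L * m < ε / 6 := by
    intro m hm
    refine lt_of_le_of_lt ?_ hL
    calc A / 9 ^ L * m ≤ A / 9 ^ L * (2 * 4 ^ (d + L)) := by
          gcongr
          have : (1 : ℝ) ≤ 4 ^ (d + L) := one_le_pow₀ (by norm_num)
          linarith
      _ = _ := by rw [div_pow, pow_add]; ring
  have hmσ := hbd _ ((hσ2 (d + L)).trans (by linarith))
  have hmν := hbd (∫ x, x ^ (2 * (d + L)) ∂ν) (by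
    have h1 := (hclose (2 * (d + L)) (by omega)).trans_le (min_le_left _ _)
    have h2 := hσ2 (d + L)
    linarith [(abs_lt.1 h1).2])
  have hpdiff : |∫ x, p.eval x ∂ν - ∫ x, p.eval x ∂σ| ≤ ε / 6 := by
    rw [(hpi ν hν).2, (hpi σ hσ).2, ← Finset.sum_sub_distrib]
    calc _ ≤ ∑ i ∈ Finset.range (d + 1), |p.coeff i| * (ε / (6 * (S + 1))) := by
          refine (Finset.abs_sum_le_sum_abs _ _).trans (Finset.sum_le_sum fun i hi => ?_)
          rw [← mul_sub, abs_mul]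
          gcongr
          have := Finset.mem_range.1 hi
          exact ((hclose i (by omega)).trans_le (min_le_right _ _)).le
      _ = S / (S + 1) * (ε / 6) := by
          rw [← Finset.sum_mul]
          field_simp
          rfl
      _ ≤ 1 * (ε / 6) := by
          gcongr
          rw [div_le_one (by positivity)]
          linarith
      _ = ε / 6 := one_mul _
  have t1 := abs_le.1 (happ ν hν1 hν)
  have t2 := abs_le.1 (happ σ inferInstance hσ)
  have t3 := abs_le.1 hpdiff
  rw [abs_lt]
  constructor <;> linarith [t1.1, t1.2, t2.1, t2.2, t3.1, t3.2]

end MomentMethod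
-- Row counts of band matrices and the trace formula.
section Band

lemma relevant_iff {n m : ℕ} (hm : 2 * m + 1 < n) (p q : Fin n) :
    Relevant n (2 * m + 1) p q ↔
      ((p : ℕ) ≤ q + m ∧ (q : ℕ) ≤ p + m) ∨ (n + q ≤ p + m ∨ n + p ≤ q + m) := by
  unfold Relevant
  have h1 : (((2 * m + 1 : ℕ) : ℝ) - 1) / 2 = m := by push_cast; ring
  rw [h1, abs_le, le_abs, or_iff_right (by omega : ¬ 2 * m + 1 = n)]
  have c1 : (p : ℕ) ≤ q + m ↔ ((p : ℕ) : ℝ) - (q : ℕ) ≤ m := by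
    rw [sub_le_iff_le_add']; exact_mod_cast Iff.rfl
  have c2 : (q : ℕ) ≤ p + m ↔ -(m : ℝ) ≤ ((p : ℕ) : ℝ) - (q : ℕ) := by
    rw [neg_le_sub_iff_le_add]; exact_mod_cast (by rfl)
  have c3 : n + q ≤ p + m ↔ (n : ℝ) - m ≤ ((p : ℕ) : ℝ) - (q : ℕ) := by
    rw [sub_le_iff_le_add, sub_add_eq_add_sub, le_sub_iff_add_le]; exact_mod_cast Iff.rfl
  have c4 : n + p ≤ q + m ↔ (n : ℝ) - m ≤ -(((p : ℕ) : ℝ) - (q : ℕ)) := by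
    rw [neg_sub, sub_le_iff_le_add, sub_add_eq_add_sub, le_sub_iff_add_le]; exact_mod_cast Iff.rfl
  rw [c1, c2, c3, c4, and_comm]

/-- Every row of a periodic band matrix has exactly as many relevant entries as its bandwidth. -/
lemma card_nbrs_relevant {n b : ℕ} (hb : IsBandwidth n b) (u : Fin n) :
    (nbrs (Relevant n b) u).card = b := by
  classical
  rcases hb with ⟨-, hlt, m, rfl⟩ | rfl
  · have hu := u.2
    have himg : (nbrs (Relevant n (2 * m + 1)) u).map Fin.valEmbedding
        = (Finset.range n).filter fun q =>
          ((u : ℕ) ≤ q + m ∧ q ≤ u + m) ∨ (n + q ≤ u + m ∨ n + u ≤ q + m) := by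
      ext q
      simp only [nbrs, Finset.mem_map, Finset.mem_filter, Finset.mem_univ, true_and,
        Finset.mem_range, Fin.valEmbedding_apply, relevant_iff hlt]
      constructor
      · rintro ⟨q, h, rfl⟩
        exact ⟨q.2, h⟩
      · rintro ⟨hq, h⟩
        exact ⟨⟨q, hq⟩, h, rfl⟩
    rw [← Finset.card_map Fin.valEmbedding, himg]
    -- The cyclic window of radius `m` around `u` is one interval in the middle rows, and two
    -- intervals when it wraps past 0 or past `n`; as `2 * m + 1 < n` it cannot do both.
    by_cases h1 : (u : ℕ) < m
    · have : ((Finset.range n).filter fun q =>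
          ((u : ℕ) ≤ q + m ∧ q ≤ u + m) ∨ (n + q ≤ u + m ∨ n + u ≤ q + m))
          = Finset.Ico 0 (u + m + 1) ∪ Finset.Ico (n + u - m) n := by
        ext q
        simp only [Finset.mem_filter, Finset.mem_range, Finset.mem_union, Finset.mem_Ico]
        omega
      rw [this, Finset.card_union_of_disjoint, Nat.card_Ico, Nat.card_Ico]
      · omega
      · rw [Finset.disjoint_left]
        intro q
        simp only [Finset.mem_Ico]
        omega
    · by_cases h2 : u + m < n
      · have : ((Finset.range n).filter fun q =>
            ((u : ℕ) ≤ q + m ∧ q ≤ u + m) ∨ (n + q ≤ u + m ∨ n + u ≤ q + m))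
            = Finset.Ico (u - m : ℕ) (u + m + 1) := by
          ext q
          simp only [Finset.mem_filter, Finset.mem_range, Finset.mem_Ico]
          omega
        rw [this, Nat.card_Ico]
        omega
      · have : ((Finset.range n).filter fun q =>
            ((u : ℕ) ≤ q + m ∧ q ≤ u + m) ∨ (n + q ≤ u + m ∨ n + u ≤ q + m))
            = Finset.Ico 0 (u + m + 1 - n) ∪ Finset.Ico (u - m : ℕ) n := by
          ext q
          simp only [Finset.mem_filter, Finset.mem_range, Finset.mem_union, Finset.mem_Ico]
          omega
        rw [this, Finset.card_union_of_disjoint, Nat.card_Ico, Nat.card_Ico]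
        · omega
        · rw [Finset.disjoint_left]
          intro q
          simp only [Finset.mem_Ico]
          omega
  · have h : ∀ v ∈ Finset.univ, Relevant b b u v := fun _ _ => Or.inl rfl
    rw [nbrs, Finset.filter_true_of_mem h, Finset.card_univ, Fintype.card_fin]

open Classical in
/-- The entries of the powers of a band matrix are sums over paths. -/
lemma scaledBand_pow_apply {n b : ℕ} {A : Matrix (Fin n) (Fin n) ℝ} (hA : A.IsSymm) (k : ℕ)
    (u v : Fin n) :
    (scaledBand b A ^ k) u v = (1 / √(b : ℝ)) ^ k *
      ∑ l ∈ (paths (Relevant n b) k u).filter (fun l => (u :: l).getLast (by simp) = v),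
        edgeProd A (edges u l) := by
  induction k generalizing u with
  | zero =>
    rw [paths_zero, Finset.filter_singleton]
    by_cases h : u = v <;> simp [h, edgeProd]
  | succ k ih =>
    rw [pow_succ', Matrix.mul_apply, Finset.sum_filter, sum_paths_succ, nbrs, Finset.sum_filter,
      Finset.mul_sum]
    refine Finset.sum_congr rfl fun w _ => ?_
    rw [ih, Finset.sum_filter]
    by_cases h : Relevant n b u w
    · rw [if_pos h]
      simp only [scaledBand, band, Matrix.smul_apply, Matrix.of_apply, if_pos h, smul_eq_mul,
        edges_cons, edgeProd_cons, entry_mk hA, List.getLast_cons_cons]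
      have : ∀ S : Finset (List (Fin n)),
          (∑ l ∈ S, if (w :: l).getLast (by simp) = v then A u w * edgeProd A (edges w l) else 0)
          = A u w * ∑ l ∈ S, if (w :: l).getLast (by simp) = v then edgeProd A (edges w l) else 0 := by
        intro S
        rw [Finset.mul_sum]
        refine Finset.sum_congr rfl fun l _ => ?_
        split_ifs <;> simp
      rw [this]
      ring
    · simp [scaledBand, band, h]

lemma trace_scaledBand_pow {n b : ℕ} {A : Matrix (Fin n) (Fin n) ℝ} (hA : A.IsSymm) (k : ℕ) :
    (n : ℝ)⁻¹ * (scaledBand b A ^ k).trace = treePart (Relevant n b) (1 / √(b : ℝ)) k A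
      + nonTreePart (Relevant n b) (1 / √(b : ℝ)) k A := by
  classical
  rw [treePart, nonTreePart, ← mul_add, ← sum_closed_paths _ k fun r l => edgeProd A (edges r l),
    Matrix.trace, mul_assoc]
  simp only [Matrix.diag_apply, scaledBand_pow_apply hA, ← Finset.mul_sum]

end Band

/-! ### Integrals against the empirical spectral distribution. -/

section Esd

variable {n : ℕ} {A : Matrix (Fin n) (Fin n) ℝ} (hA : A.IsHermitian)

lemma coe_esd : (esd A hA : Measure ℝ)
    = (n : ℝ≥0)⁻¹ • ∑ i, Measure.dirac (hA.eigenvalues i) := by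
  rw [esd, FiniteMeasure.toMeasure_smul, FiniteMeasure.toMeasure_sum]
  rfl

lemma integrable_esd (g : ℝ → ℝ) : Integrable g (esd A hA : Measure ℝ) := by
  rw [coe_esd]
  refine Integrable.smul_measure_nnreal ?_
  rw [integrable_finsetSum_measure]
  exact fun i _ => integrable_dirac (by simp)

lemma integral_esd (g : ℝ → ℝ) :
    ∫ x, g x ∂(esd A hA : Measure ℝ) = (n : ℝ)⁻¹ * ∑ i, g (hA.eigenvalues i) := by
  rw [coe_esd, integral_smul_nnreal_measure,
    integral_finsetSum_measure fun i _ => integrable_dirac (by simp)]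
  simp only [integral_dirac]
  rw [NNReal.smul_def]
  simp

lemma isProbabilityMeasure_esd (hn : 1 ≤ n) : IsProbabilityMeasure (esd A hA : Measure ℝ) := by
  constructor
  rw [coe_esd]
  have : (n : ℝ≥0∞) ≠ 0 := by simp; omega
  rw [Measure.smul_apply, Measure.finsetSum_apply, ENNReal.smul_def]
  simp only [measure_univ, Finset.sum_const, Finset.card_univ, Fintype.card_fin, nsmul_eq_mul,
    mul_one, smul_eq_mul]
  rw [ENNReal.coe_inv (by simp; omega), ENNReal.coe_natCast]
  exact ENNReal.inv_mul_cancel this (by simp)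

lemma trace_pow_eq_sum_eigenvalues (k : ℕ) :
    (A ^ k).trace = ∑ i, hA.eigenvalues i ^ k := by
  conv_lhs => rw [hA.spectral_theorem, ← map_pow, Unitary.conjStarAlgAut_apply,
    Matrix.trace_mul_cycle, Matrix.diagonal_pow]
  simp [Matrix.trace]

lemma integral_pow_esd (k : ℕ) :
    ∫ x, x ^ k ∂(esd A hA : Measure ℝ) = (n : ℝ)⁻¹ * (A ^ k).trace := by
  rw [integral_esd hA, trace_pow_eq_sum_eigenvalues hA]

end Esd

/-! ### Markov's inequality and Borel–Cantelli. -/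

section Convergence

variable {Ω : Type*} [MeasurableSpace Ω] {μ : Measure Ω}

lemma measure_ge_le_of_integral_pow {f : Ω → ℝ} {M : ℕ} (hM : Even M) (hf : Integrable
    (fun ω => f ω ^ M) μ) [IsFiniteMeasure μ] {u ε : ℝ} (hu : ∫ ω, f ω ^ M ∂μ ≤ u) (hε : 0 < ε) :
    μ {ω | ε ≤ |f ω|} ≤ ENNReal.ofReal ((ε ^ M)⁻¹ * u) := by
  have h1 := mul_meas_ge_le_integral_of_nonneg
    (Eventually.of_forall fun ω => hM.pow_nonneg (f ω)) hf (ε ^ M)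
  have h2 : μ.real {ω | ε ≤ |f ω|} ≤ μ.real {ω | ε ^ M ≤ f ω ^ M} := by
    refine measureReal_mono fun ω hω => ?_
    have hω : ε ≤ |f ω| := hω
    change ε ^ M ≤ f ω ^ M
    rw [← hM.pow_abs (f ω)]
    gcongr
  rw [← ofReal_measureReal]
  refine ENNReal.ofReal_le_ofReal ?_
  rw [← div_eq_inv_mul, le_div_iff₀ (by positivity)]
  calc _ ≤ μ.real {ω | ε ^ M ≤ f ω ^ M} * ε ^ M := by gcongr
    _ ≤ _ := by linarith

lemma tendsto_measure_ge_of_integral_pow [IsFiniteMeasure μ] {f : ℕ → Ω → ℝ} {u : ℕ → ℝ} {M : ℕ}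
    (hM : Even M)
    (hf : ∀ n, 1 ≤ n → Integrable (fun ω => f n ω ^ M) μ ∧ ∫ ω, f n ω ^ M ∂μ ≤ u n)
    (hu : Tendsto u atTop (𝓝 0)) {ε : ℝ} (hε : 0 < ε) :
    Tendsto (fun n => μ {ω | ε ≤ |f n ω|}) atTop (𝓝 0) := by
  have h1 : Tendsto (fun n => ENNReal.ofReal ((ε ^ M)⁻¹ * u n)) atTop (𝓝 0) := by
    have := ENNReal.tendsto_ofReal (hu.const_mul (ε ^ M)⁻¹)
    simpa using this
  refine tendsto_of_tendsto_of_tendsto_of_le_of_le' tendsto_const_nhds h1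
    (Eventually.of_forall fun _ => zero_le) ?_
  filter_upwards [eventually_ge_atTop 1] with n hn
  exact measure_ge_le_of_integral_pow hM (hf n hn).1 (hf n hn).2 hε

/-- Borel–Cantelli at each of the countably many levels `1 / (j + 1)`, with the index shifted
because the bounds start at `n = 1`. -/
lemma ae_tendsto_of_integral_pow [IsFiniteMeasure μ] {f : ℕ → Ω → ℝ} {u : ℕ → ℝ} {M : ℕ}
    (hM : Even M)
    (hf : ∀ n, 1 ≤ n → Integrable (fun ω => f n ω ^ M) μ ∧ ∫ ω, f n ω ^ M ∂μ ≤ u n)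
    (hu : Summable u) : ∀ᵐ ω ∂μ, Tendsto (fun n => f n ω) atTop (𝓝 0) := by
  have hkey : ∀ j : ℕ, ∀ᵐ ω ∂μ, ∀ᶠ n in atTop, ω ∉ {ω | 1 / ((j : ℝ) + 1) ≤ |f (n + 1) ω|} := by
    intro j
    refine ae_eventually_notMem (ne_top_of_le_ne_top ?_ (ENNReal.tsum_le_tsum fun n =>
      measure_ge_le_of_integral_pow hM (hf (n + 1) (by omega)).1 (hf (n + 1) (by omega)).2
        (by positivity)))
    exact (((summable_nat_add_iff 1).2 hu).mul_left _).tsum_ofReal_ne_top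
  filter_upwards [ae_all_iff.2 hkey] with ω hω
  rw [← tendsto_add_atTop_iff_nat 1, Metric.tendsto_atTop']
  intro ε hε
  obtain ⟨j, hj⟩ := exists_nat_one_div_lt hε
  obtain ⟨N, hN⟩ := eventually_atTop.1 (hω j)
  refine ⟨N, fun n hn => ?_⟩
  have := hN n hn.le
  rw [Real.dist_eq, sub_zero]
  exact (not_le.1 this).trans hj

/-- If `b n ^ p ≤ n`, then `1 / n` is at most the summable `b n ^ (-p)`. Otherwise `b n ≥ n ^ (1 /
p)`, and the term is at most `n ^ (-1 - 1 / p)`. -/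
lemma summable_inv_mul_inv {b : ℕ → ℕ} {p : ℕ} (hp : 1 ≤ p)
    (hb : Summable fun n : ℕ => ((b n : ℝ) ^ p)⁻¹) (hb1 : ∀ n, 1 ≤ n → 1 ≤ b n) :
    Summable fun n : ℕ => ((b n : ℝ))⁻¹ * (n : ℝ)⁻¹ := by
  have hp0 : (0 : ℝ) < p := by exact_mod_cast hp
  have hs : Summable fun n : ℕ => 1 / (n : ℝ) ^ (1 + 1 / (p : ℝ)) :=
    Real.summable_one_div_nat_rpow.2 (by linarith [one_div_pos.2 hp0])
  refine Summable.of_nonneg_of_le (fun n => by positivity) (fun n => ?_) (hb.add hs)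
  rcases Nat.eq_zero_or_pos n with rfl | hn
  · simp
    positivity
  have hn0 : (0 : ℝ) < n := by exact_mod_cast hn
  have hb0 : (1 : ℝ) ≤ b n := by exact_mod_cast hb1 n hn
  rcases le_total ((b n : ℝ) ^ p) n with h | h
  · refine le_trans ?_ (le_add_of_nonneg_right (by positivity))
    calc ((b n : ℝ))⁻¹ * (n : ℝ)⁻¹ ≤ 1 * ((b n : ℝ) ^ p)⁻¹ := by
          gcongr
          exact inv_le_one_of_one_le₀ hb0
      _ = _ := one_mul _
  · refine le_trans ?_ (le_add_of_nonneg_left (by positivity))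
    have h1 : (n : ℝ) ^ (1 / (p : ℝ)) ≤ b n := by
      calc (n : ℝ) ^ (1 / (p : ℝ)) ≤ ((b n : ℝ) ^ p) ^ (1 / (p : ℝ)) := by gcongr
        _ = b n := by
          rw [one_div, Real.pow_rpow_inv_natCast (by positivity) (by omega)]
    rw [Real.rpow_add hn0, Real.rpow_one, one_div, mul_inv, mul_comm]
    gcongr

end Convergence
-- Convergence of moments and the two semicircle laws.
lemma IsBandwidth.one_le {n b : ℕ} (hb : IsBandwidth n b) (hn : 1 ≤ n) : 1 ≤ b := by
  rcases hb with h | h <;> omega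

lemma IsBandwidth.le {n b : ℕ} (hb : IsBandwidth n b) : b ≤ n := by
  rcases hb with h | h <;> omega

section Scale

variable {n b : ℕ}

lemma one_div_sqrt_sq (b : ℕ) : (1 / √(b : ℝ)) ^ 2 = (b : ℝ)⁻¹ := by
  rw [div_pow, Real.sq_sqrt (Nat.cast_nonneg b), one_pow, one_div]

lemma one_div_sqrt_le_one (hb : 1 ≤ b) : 1 / √(b : ℝ) ≤ 1 := by
  rw [div_le_one (by positivity)]
  exact Real.one_le_sqrt.2 (by exact_mod_cast hb)

lemma inv_mul_card_nbrs_le (hb : IsBandwidth n b) (hn : 1 ≤ n) (u : Fin n) :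
    (1 / √(b : ℝ)) ^ 2 * (nbrs (Relevant n b) u).card ≤ 1 := by
  rw [card_nbrs_relevant hb, one_div_sqrt_sq]
  have := hb.one_le hn
  rw [inv_mul_cancel₀ (by positivity)]

lemma one_le_mul_inv (hb : IsBandwidth n b) (hn : 1 ≤ n) :
    1 ≤ (n : ℝ) * (1 / √(b : ℝ)) ^ 2 := by
  rw [one_div_sqrt_sq, ← div_eq_mul_inv, one_le_div (by exact_mod_cast hb.one_le hn)]
  exact_mod_cast hb.le

end Scale

variable {b : ℕ → ℕ}

/-- The upper bound `ballot k 0` is exact up to `θ ^ k` with `θ = 1 - (k + 1) / b n`, since a walk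
of length `k` excludes at most `k + 1` vertices. -/
lemma tendsto_treeMean (hb : ∀ n : ℕ, 1 ≤ n → IsBandwidth n (b n)) (hb_top : Tendsto b atTop atTop)
    (k : ℕ) : Tendsto (fun n => treeMean (Relevant n (b n)) (1 / √(b n : ℝ)) k) atTop
      (𝓝 (ballot k 0)) := by
  have hbr : Tendsto (fun n => (b n : ℝ)⁻¹) atTop (𝓝 0) :=
    tendsto_inv_atTop_zero.comp (tendsto_natCast_atTop_atTop.comp hb_top)
  have hlow : Tendsto (fun n => (ballot k 0 : ℝ) * (1 - (b n : ℝ)⁻¹ * (k + 1 : ℕ)) ^ k) atTop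
      (𝓝 (ballot k 0)) := by
    have := ((hbr.mul_const ((k + 1 : ℕ) : ℝ)).const_sub 1).pow k |>.const_mul (ballot k 0 : ℝ)
    simpa using this
  refine tendsto_of_tendsto_of_tendsto_of_le_of_le' hlow tendsto_const_nhds ?_ ?_
  · filter_upwards [eventually_ge_atTop 1, hb_top.eventually_ge_atTop (k + 1)] with n hn hbn
    have hn0 : (0 : ℝ) < n := by exact_mod_cast hn
    have hb0 : (0 : ℝ) < b n := by exact_mod_cast (hb n hn).one_le hn
    have hle := le_card_treeWalks (rel := Relevant n (b n)) (β := 1 / √(b n : ℝ))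
      (θ := 1 - (b n : ℝ)⁻¹ * (k + 1 : ℕ)) (by positivity)
      (by
        rw [sub_nonneg, inv_mul_le_iff₀ hb0, mul_one]
        exact_mod_cast hbn)
      (by
        rw [sub_le_self_iff]
        positivity)
      (fun u v => Relevant.comm.1) k (fun u => by
        rw [card_nbrs_relevant (hb n hn), one_div_sqrt_sq, mul_sub, inv_mul_cancel₀ hb0.ne'])
    rw [Fintype.card_fin] at hle
    rw [treeMean, mul_assoc]
    calc _ = (n : ℝ)⁻¹ * (n * ballot k 0 * (1 - (b n : ℝ)⁻¹ * (k + 1 : ℕ)) ^ k) := by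
          field_simp
      _ ≤ _ := by gcongr
  · filter_upwards [eventually_ge_atTop 1] with n hn
    have hn0 : (0 : ℝ) < n := by exact_mod_cast hn
    have hb0 : (0 : ℝ) < b n := by exact_mod_cast (hb n hn).one_le hn
    have hle := card_treeWalks_le (rel := Relevant n (b n)) (β := 1 / √(b n : ℝ)) (by positivity)
      (inv_mul_card_nbrs_le (hb n hn) hn) k
    rw [Fintype.card_fin] at hle
    rw [treeMean, mul_assoc]
    calc _ ≤ (n : ℝ)⁻¹ * (n * ballot k 0) := by gcongr
      _ = _ := by field_simp

variable {Ω : Type*} [MeasurableSpace Ω] {μ : Measure Ω}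
  {a : (n : ℕ) → Ω → Matrix (Fin n) (Fin n) ℝ} {C : ℕ → ℝ} {Cn : ℕ → ℕ → ℝ}

/-- The bound on the second moment of the centred contribution of the tree walks. -/
noncomputable def treeBound (C : ℕ → ℝ) (Cn : ℕ → ℕ → ℝ) (b : ℕ → ℕ) (k n : ℕ) : ℝ :=
  (ballot k 0 : ℝ) ^ 2 * (|Cn k n| + 2 * |Cn (k / 2) n|)
    + ballot k 0 * (2 * k ^ 2 * ((k : ℝ) + 3) ^ k) * (|C (2 * k)| + 2 * |C k| + 1)
      * ((b n : ℝ)⁻¹ * (n : ℝ)⁻¹)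

lemma IsApproxUncorrelated.integral_treePart_sq_le [IsProbabilityMeasure μ]
    (ha : IsApproxUncorrelated μ a C Cn) (hb : ∀ n : ℕ, 1 ≤ n → IsBandwidth n (b n)) {k : ℕ}
    (hk : 1 ≤ k) (n : ℕ) (hn : 1 ≤ n) :
    Integrable (fun ω => (treePart (Relevant n (b n)) (1 / √(b n : ℝ)) k (a n ω)
      - treeMean (Relevant n (b n)) (1 / √(b n : ℝ)) k) ^ 2) μ ∧
    ∫ ω, (treePart (Relevant n (b n)) (1 / √(b n : ℝ)) k (a n ω)
      - treeMean (Relevant n (b n)) (1 / √(b n : ℝ)) k) ^ 2 ∂μ ≤ treeBound C Cn b k n := by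
  have hb0 := (hb n hn).one_le hn
  have := ha.integral_treePart_sub_sq (rel := Relevant n (b n)) (β := 1 / √(b n : ℝ))
    (by positivity) (one_div_sqrt_le_one hb0) (inv_mul_card_nbrs_le (hb n hn) hn)
    (one_le_mul_inv (hb n hn) hn) hk
  rwa [one_div_sqrt_sq] at this

lemma IsApproxUncorrelated.integral_nonTreePart_pow_le
    (ha : IsApproxUncorrelated μ a C Cn) (hb : ∀ n : ℕ, 1 ≤ n → IsBandwidth n (b n)) {k p : ℕ}
    (hk : 1 ≤ k) (hp : 1 ≤ p) (n : ℕ) (hn : 1 ≤ n) :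
    Integrable (fun ω =>
      nonTreePart (Relevant n (b n)) (1 / √(b n : ℝ)) k (a n ω) ^ (2 * p)) μ ∧
    ∫ ω, nonTreePart (Relevant n (b n)) (1 / √(b n : ℝ)) k (a n ω) ^ (2 * p) ∂μ
      ≤ |C (k * (2 * p))| * (((2 * p * (k + 1) : ℕ) : ℝ) + 1) ^ ((k + 1) * (2 * p))
        * ((b n : ℝ) ^ p)⁻¹ := by
  have hb0 := (hb n hn).one_le hn
  have := ha.integral_nonTreePart_pow (rel := Relevant n (b n)) (β := 1 / √(b n : ℝ))
    (by positivity) (one_div_sqrt_le_one hb0) (inv_mul_card_nbrs_le (hb n hn) hn)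
    (one_le_mul_inv (hb n hn) hn) hk (by omega : 1 ≤ 2 * p)
  rwa [pow_mul (1 / √(b n : ℝ)), one_div_sqrt_sq, inv_pow] at this

lemma ballot_one_zero : ballot 1 0 = 0 := rfl

lemma tendsto_treeBound (hC : ∀ ℓ, 1 ≤ ℓ → Tendsto (fun n => Cn ℓ n) atTop (𝓝 0))
    (hb_top : Tendsto b atTop atTop) {k : ℕ} (hk : 1 ≤ k) :
    Tendsto (treeBound C Cn b k) atTop (𝓝 0) := by
  unfold treeBound
  -- For `k = 1` the bound involves `Cn 0`, which is uncontrolled, but `ballot 1 0 = 0` removes it.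
  rcases Nat.eq_or_lt_of_le hk with rfl | hk2
  · simp [ballot_one_zero]
  have hbr : Tendsto (fun n => (b n : ℝ)⁻¹) atTop (𝓝 0) :=
    tendsto_inv_atTop_zero.comp (tendsto_natCast_atTop_atTop.comp hb_top)
  have h1 := (hC k hk).abs
  have h2 := (hC (k / 2) (by omega)).abs
  have := ((h1.add (h2.const_mul 2)).const_mul ((ballot k 0 : ℝ) ^ 2)).add
    ((hbr.mul tendsto_inv_atTop_nhds_zero_nat).const_mul
      (ballot k 0 * (2 * k ^ 2 * ((k : ℝ) + 3) ^ k) * (|C (2 * k)| + 2 * |C k| + 1)))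
  simpa using this

lemma summable_treeBound (hC : ∀ ℓ, 1 ≤ ℓ → Summable fun n => Cn ℓ n)
    (hb : Summable fun n : ℕ => ((b n : ℝ))⁻¹ * (n : ℝ)⁻¹) {k : ℕ} (hk : 1 ≤ k) :
    Summable (treeBound C Cn b k) := by
  unfold treeBound
  rcases Nat.eq_or_lt_of_le hk with rfl | hk2
  · simp [ballot_one_zero, summable_zero]
  exact (((hC k hk).abs.add ((hC (k / 2) (by omega)).abs.mul_left 2)).mul_left _).add
    (hb.mul_left _)

/-- The empirical spectral distribution of the band matrix. -/
noncomputable abbrev bandEsd (ha : IsApproxUncorrelated μ a C Cn) (b : ℕ → ℕ) (n : ℕ) (ω : Ω) :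
    FiniteMeasure ℝ :=
  esd (scaledBand (b n) (a n ω)) (isHermitian_scaledBand (b n) (ha.symm n ω))

lemma integral_pow_bandEsd (ha : IsApproxUncorrelated μ a C Cn) (b : ℕ → ℕ) (k n : ℕ) (ω : Ω) :
    ∫ x, x ^ k ∂(bandEsd ha b n ω : Measure ℝ)
      = treePart (Relevant n (b n)) (1 / √(b n : ℝ)) k (a n ω)
        + nonTreePart (Relevant n (b n)) (1 / √(b n : ℝ)) k (a n ω) := by
  rw [integral_pow_esd, trace_scaledBand_pow (ha.symm n ω)]

lemma integral_zeroth_pow (ν : Measure ℝ) [IsProbabilityMeasure ν] :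
    ∫ x, x ^ 0 ∂ν = (ballot 0 0 : ℝ) := by
  simp [ballot]

lemma tendsto_measure_moment [IsProbabilityMeasure μ] (ha : IsApproxUncorrelated μ a C Cn)
    (hb : ∀ n : ℕ, 1 ≤ n → IsBandwidth n (b n)) (hb_top : Tendsto b atTop atTop) (k : ℕ)
    {δ : ℝ} (hδ : 0 < δ) :
    Tendsto (fun n => μ {ω | δ ≤ |∫ x, x ^ k ∂(bandEsd ha b n ω : Measure ℝ) - ballot k 0|})
      atTop (𝓝 0) := by
  rcases Nat.eq_zero_or_pos k with rfl | hk
  · refine tendsto_const_nhds.congr' ?_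
    filter_upwards [eventually_ge_atTop 1] with n hn
    symm
    convert measure_empty (μ := μ) using 2
    ext ω
    have := isProbabilityMeasure_esd (isHermitian_scaledBand (b n) (ha.symm n ω)) hn
    rw [Set.mem_ofPred_eq, integral_zeroth_pow, sub_self, abs_zero]
    simpa using hδ
  have hbr : Tendsto (fun n => ((b n : ℝ) ^ 1)⁻¹) atTop (𝓝 0) := by
    simp only [pow_one]
    exact tendsto_inv_atTop_zero.comp (tendsto_natCast_atTop_atTop.comp hb_top)
  -- The error is split into the fluctuation of the tree part, the non-tree part and the
  -- deterministic bias of `treeMean`, each allowed `δ / 3`. The second moment of the non-tree part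
  -- suffices here.
  have h1 := tendsto_measure_ge_of_integral_pow even_two (ha.integral_treePart_sq_le hb hk)
    (tendsto_treeBound ha.tendsto_zero hb_top hk) (ε := δ / 3) (by positivity)
  have h2 := tendsto_measure_ge_of_integral_pow (by simp)
    (ha.integral_nonTreePart_pow_le hb hk le_rfl) (by simpa using hbr.const_mul _)
    (ε := δ / 3) (by positivity)
  have h3 := h1.add h2
  rw [add_zero] at h3
  refine tendsto_of_tendsto_of_tendsto_of_le_of_le' tendsto_const_nhds h3
    (Eventually.of_forall fun _ => zero_le) ?_
  filter_upwards [Metric.tendsto_nhds.1 (tendsto_treeMean hb hb_top k) (δ / 3) (by positivity)]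
    with n hn
  refine (measure_mono ?_).trans (measure_union_le _ _)
  intro ω hω
  rw [Set.mem_ofPred_eq, integral_pow_bandEsd] at hω
  rw [Set.mem_union, Set.mem_ofPred_eq, Set.mem_ofPred_eq]
  by_contra! h
  rw [Real.dist_eq] at hn
  obtain ⟨u1, u2⟩ := abs_lt.1 h.1
  obtain ⟨v1, v2⟩ := abs_lt.1 h.2
  obtain ⟨w1, w2⟩ := abs_lt.1 hn
  refine absurd hω (not_le.2 (abs_lt.2 ⟨by linarith, by linarith⟩))

lemma ae_tendsto_moment [IsProbabilityMeasure μ] (ha : IsApproxUncorrelated μ a C Cn)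
    (hb : ∀ n : ℕ, 1 ≤ n → IsBandwidth n (b n)) (hb_top : Tendsto b atTop atTop)
    {p : ℕ} (hp : 1 ≤ p) (hbp : Summable fun n : ℕ => ((b n : ℝ) ^ p)⁻¹)
    (hC : ∀ ℓ, 1 ≤ ℓ → Summable fun n => Cn ℓ n) (k : ℕ) :
    ∀ᵐ ω ∂μ, Tendsto (fun n => ∫ x, x ^ k ∂(bandEsd ha b n ω : Measure ℝ)) atTop
      (𝓝 (ballot k 0)) := by
  rcases Nat.eq_zero_or_pos k with rfl | hk
  · refine Eventually.of_forall fun ω => tendsto_const_nhds.congr' ?_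
    filter_upwards [eventually_ge_atTop 1] with n hn
    have := isProbabilityMeasure_esd (isHermitian_scaledBand (b n) (ha.symm n ω)) hn
    rw [integral_zeroth_pow]
  have hs := summable_inv_mul_inv hp hbp fun n hn => (hb n hn).one_le hn
  filter_upwards [ae_tendsto_of_integral_pow even_two (ha.integral_treePart_sq_le hb hk)
    (summable_treeBound hC hs hk), ae_tendsto_of_integral_pow (by simp)
    (ha.integral_nonTreePart_pow_le hb hk hp) (hbp.mul_left _)] with ω h1 h2
  have := (h1.add h2).add (tendsto_treeMean hb hb_top k)
  rw [zero_add, zero_add] at this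
  refine this.congr fun n => ?_
  rw [integral_pow_bandEsd]
  ring

/-- The method of moments for the semicircle distribution. -/
lemma exists_moments_close_semicircle (f : ℝ →ᵇ ℝ) {ε : ℝ} (hε : 0 < ε) :
    ∃ (K : ℕ) (δ : ℝ), 0 < δ ∧ ∀ ν : Measure ℝ, IsProbabilityMeasure ν →
      (∀ k, Integrable (fun x : ℝ => x ^ k) ν) →
      (∀ k < K, |∫ x, x ^ k ∂ν - ballot k 0| < δ) →
      |∫ x, f x ∂ν - ∫ x, f x ∂semicircleMeasure| < ε := by
  have := exists_moments_close semicircleMeasure integrable_pow_semicircleMeasure (fun k => by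
    rw [integral_pow_semicircleMeasure]
    have h := ballot_le (2 * k) 0
    rw [pow_mul] at h
    exact_mod_cast h) f hε
  simpa only [integral_pow_semicircleMeasure] using this

theorem semicircleLawInProbability [IsProbabilityMeasure μ] (ha : IsApproxUncorrelated μ a C Cn)
    (hb : ∀ n : ℕ, 1 ≤ n → IsBandwidth n (b n)) (hb_top : Tendsto b atTop atTop) :
    SemicircleLawInProbability μ (fun n ω => scaledBand (b n) (a n ω))
      (fun n ω => isHermitian_scaledBand (b n) (ha.symm n ω)) := by
  intro f
  rw [tendstoInMeasure_iff_norm]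
  intro ε hε
  obtain ⟨K, δ, hδ, hclose⟩ := exists_moments_close_semicircle f hε
  have h1 : Tendsto (fun n => ∑ k ∈ Finset.range K,
      μ {ω | δ ≤ |∫ x, x ^ k ∂(bandEsd ha b n ω : Measure ℝ) - ballot k 0|}) atTop (𝓝 0) := by
    have := tendsto_finsetSum (Finset.range K) fun k _ =>
      tendsto_measure_moment ha hb hb_top k hδ
    simpa using this
  refine tendsto_of_tendsto_of_tendsto_of_le_of_le' tendsto_const_nhds h1
    (Eventually.of_forall fun _ => zero_le) ?_
  -- For `n = 0` the spectral distribution is the zero measure. For `n ≥ 1`, a deviation of the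
  -- integral of `f` forces one of the first `K` moments to deviate, and a union bound applies.
  filter_upwards [eventually_ge_atTop 1] with n hn
  refine (measure_mono ?_).trans (measure_biUnion_finset_le (Finset.range K) _)
  intro ω hω
  by_contra h
  simp only [Set.mem_iUnion, Set.mem_ofPred_eq, Finset.mem_range, not_exists, not_le] at h
  exact absurd hω (not_le.2 (hclose _ (isProbabilityMeasure_esd _ hn)
    (fun k => integrable_esd _ _) h))

theorem semicircleLawAlmostSurely [IsProbabilityMeasure μ] (ha : IsApproxUncorrelated μ a C Cn)
    (hb : ∀ n : ℕ, 1 ≤ n → IsBandwidth n (b n)) (hb_top : Tendsto b atTop atTop)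
    {p : ℕ} (hp : 1 ≤ p) (hbp : Summable fun n : ℕ => ((b n : ℝ) ^ p)⁻¹)
    (hC : ∀ ℓ, 1 ≤ ℓ → Summable fun n => Cn ℓ n) :
    SemicircleLawAlmostSurely μ (fun n ω => scaledBand (b n) (a n ω))
      (fun n ω => isHermitian_scaledBand (b n) (ha.symm n ω)) := by
  -- A single null set serves all moments, hence all `f` simultaneously.
  filter_upwards [ae_all_iff.2 (ae_tendsto_moment ha hb hb_top hp hbp hC)] with ω hω
  rw [FiniteMeasure.tendsto_iff_forall_integral_tendsto]
  intro f
  rw [Metric.tendsto_nhds]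
  intro ε hε
  obtain ⟨K, δ, hδ, hclose⟩ := exists_moments_close_semicircle f hε
  have h1 : ∀ᶠ n in atTop, ∀ k ∈ Finset.range K,
      |∫ x, x ^ k ∂(bandEsd ha b n ω : Measure ℝ) - ballot k 0| < δ :=
    (Finset.eventually_all _).2 fun k _ => Metric.tendsto_nhds.1 (hω k) δ hδ
  filter_upwards [eventually_ge_atTop 1, h1] with n hn h
  exact hclose _ (isProbabilityMeasure_esd _ hn) (fun k => integrable_esd _ _)
    fun k hk => h k (Finset.mem_range.2 hk)

end BandMatrix

theorem theorem2p1 {Ω : Type*} [MeasurableSpace Ω] (μ : Measure Ω) [IsProbabilityMeasure μ]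
    (a : (n : ℕ) → Ω → Matrix (Fin n) (Fin n) ℝ) (C : ℕ → ℝ) (Cn : ℕ → ℕ → ℝ)
    (ha : BandMatrix.IsApproxUncorrelated μ a C Cn)
    (b : ℕ → ℕ) (hb : ∀ n : ℕ, 1 ≤ n → BandMatrix.IsBandwidth n (b n))
    (hb_top : Tendsto b atTop atTop) :
    BandMatrix.SemicircleLawInProbability μ
      (fun n ω => BandMatrix.scaledBand (b n) (a n ω))
      (fun n ω => BandMatrix.isHermitian_scaledBand (b n) (ha.symm n ω)) ∧
    ((∃ p : ℕ, 1 ≤ p ∧ Summable fun n : ℕ => ((b n : ℝ) ^ p)⁻¹) →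
      (∀ ℓ : ℕ, 1 ≤ ℓ → Summable fun n : ℕ => Cn ℓ n) →
      BandMatrix.SemicircleLawAlmostSurely μ
        (fun n ω => BandMatrix.scaledBand (b n) (a n ω))
        (fun n ω => BandMatrix.isHermitian_scaledBand (b n) (ha.symm n ω))) :=
  ⟨BandMatrix.semicircleLawInProbability ha hb hb_top, fun ⟨_, hp, hbp⟩ hC =>
    BandMatrix.semicircleLawAlmostSurely ha hb hb_top hp hbp hC⟩
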